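/- For $B\in\mathbb R^{n\times n}$ write $\mathcal W(B)=\{x^HBx:\ x\in\mathbb C^n,\ \|x\|_2=1\}$ for its numerical range, $\mathbb C^-=\{z\in\mathbb C:\Re z<0\}$, $\|B\|_2$ for the spectral norm and $\kappa(B)=\|B\|_2\|B^{-1}\|_2$. Let $\mathrm{Off}(B)$ be the set of the blocks $B(s+1:n,\,1:s)$ and $B(1:s,\,s+1:n)$, $s=1,\dots,n-1$; $B$ is quasiseparable of order $r$ if $\max_{M\in\mathrm{Off}(B)}\mathrm{rank}(M)=r$ (with $r=0$ if $n\le 1$). For a matrix $M$ let $\sigma_1(M)\ge\sigma_2(M)\ge\cdots$ be its singular values, with $\sigma_i(M)=0$ for $i$ larger than the size of $M$. For compact $S,T\subset\mathbb C$ let $$Z_h(S,T)=\inf_{g}\ \frac{\max_{z\in S}|g(z)|}{\min_{z\in T}|g(z)|},$$ the infimum being over the rational functions $g$ with numerator and denominator of degree at most $h$, without poles in $S$ and without zeros in $T$ (where $|g|=\infty$ at a pole). Let $A,F,Q\in\mathbb R^{n\times n}$ be quasiseparable of orders $r_a,r_f,r_q$, respectively, with $\mathcal W(A)\subset\mathbb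 C^-$, $F$ symmetric positive definite and $Q$ symmetric positive semidefinite, and let $X\in\mathbb R^{n\times n}$ be the symmetric positive semidefinite (stabilizing) solution of the Riccati equation $A^\top X+XA-XFX+Q=0$. Let $F=LL^\top$ be the Cholesky factorization of $F$ ($L$ lower triangular with positive diagonal), and assume $\mathcal W(L^{-1}AL)\subset\mathbb C^-$. Then the singular values of every $M\in\mathrm{Off}(X)$ satisfy $$\frac{\sigma_{ht+r_f+1}(M)}{\|X\|_2}\ \le\ \kappa(F)\,(1+\sqrt2)^2\,Z_h(E,-E),\qquad h=1,2,\dots,$$ where $$t=4r_a+6r_f+2r_q,\qquad E=\mathcal W(L^{-1}AL)+\Big[-\tau-\sqrt{\tau^2+\|F\|_2\|Q\|_2},\ 0\Big],\qquad \tau=\big|\min\big(\mathcal W(L^{-1}AL)\cap\mathbb R\big)\big|.$$ If $X=0$, the left-hand side is read as $0$. -/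

import Mathlib

open scoped Matrix Matrix.Norms.L2Operator Pointwise ENNReal

noncomputable section

namespace QSRiccati

/-- The numerical range `{xᴴ B x : x ∈ ℂⁿ, ‖x‖₂ = 1}` of a complex matrix `B`. -/
def numericalRange {n : ℕ} (B : Matrix (Fin n) (Fin n) ℂ) : Set ℂ :=
  {z | ∃ x : EuclideanSpace ℂ (Fin n), ‖x‖ = 1 ∧ z = star x.ofLp ⬝ᵥ (B *ᵥ x.ofLp)}

/-- The numerical range of a real matrix, with complex test vectors. -/
def realNumericalRange {n : ℕ} (A : Matrix (Fin n) (Fin n) ℝ) : Set ℂ :=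
  numericalRange (A.map Complex.ofReal)

/-- The block `M(s+1:n, 1:s)` (one-based indices) of an `n × n` matrix `M`. -/
def lowerBlock {n : ℕ} (M : Matrix (Fin n) (Fin n) ℝ) (s : ℕ) :
    Matrix {i : Fin n // s ≤ (i : ℕ)} {j : Fin n // (j : ℕ) < s} ℝ :=
  M.toBlock (fun i => s ≤ (i : ℕ)) (fun j => (j : ℕ) < s)

/-- The block `M(1:s, s+1:n)` (one-based indices) of an `n × n` matrix `M`. -/
def upperBlock {n : ℕ} (M : Matrix (Fin n) (Fin n) ℝ) (s : ℕ) :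
    Matrix {i : Fin n // (i : ℕ) < s} {j : Fin n // s ≤ (j : ℕ)} ℝ :=
  M.toBlock (fun i => (i : ℕ) < s) (fun j => s ≤ (j : ℕ))

/-- The quasiseparable order: the maximal rank of the off-diagonal blocks `M(s+1:n, 1:s)` and
`M(1:s, s+1:n)`, `s = 1, …, n - 1`. -/
def qsrank {n : ℕ} (M : Matrix (Fin n) (Fin n) ℝ) : ℕ :=
  (Finset.Ico 1 n).sup fun s => max (lowerBlock M s).rank (upperBlock M s).rank

/-- The `i`-th largest singular value `σ_i(M)`, for `i = 1, 2, …`, of a rectangular real matrix;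
it is `0` when `i` exceeds the size of the matrix. (Mathlib's singular values are indexed
from `0`.) -/
def sigma {m k : Type*} [Fintype m] [Fintype k] [DecidableEq k] (i : ℕ) (M : Matrix m k ℝ) : ℝ :=
  (Matrix.toEuclideanLin M).singularValues (i - 1)

/-- The spectral condition number `κ(F) = ‖F‖₂ ‖F⁻¹‖₂` of an invertible matrix. -/
def cond {n : ℕ} (F : Matrix (Fin n) (Fin n) ℝ) : ℝ := ‖F‖ * ‖F⁻¹‖

/-- `L` is the Cholesky factor of `F`: lower triangular, with positive diagonal, `L Lᵀ = F`. -/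
structure IsCholeskyFactor {n : ℕ} (L F : Matrix (Fin n) (Fin n) ℝ) : Prop where
  lower : ∀ i j, i < j → L i j = 0
  diag_pos : ∀ i, 0 < L i i
  mul_transpose : L * Lᵀ = F

/-- The modulus `|g(z)| ∈ [0, ∞]` of `g = p / q`, with value `∞` at a pole (a zero of `q` that is
not a zero of `p`). -/
def ratModulus (p q : Polynomial ℂ) (z : ℂ) : ℝ≥0∞ := ‖p.eval z‖ₑ / ‖q.eval z‖ₑ

/-- The ratio `(max_{z ∈ E} |g(z)|) / (min_{z ∈ F} |g(z)|)` for `g = p / q`. -/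
def zolotarevRatio (p q : Polynomial ℂ) (E F : Set ℂ) : ℝ≥0∞ :=
  (⨆ z ∈ E, ratModulus p q z) / (⨅ z ∈ F, ratModulus p q z)

/-- The Zolotarev number `Z_h(E, F)` of compact sets `E`, `F`, with values in `[0, ∞]`: the optimal
ratio over the rational functions `g = p / q` with numerator and denominator of degree at most `h`.
It is enough to consider `g` without poles in `E` and without zeros in `F`; this is where, for
compact sets, the maximum over `E` is finite and the minimum over `F` is nonzero. -/
def zolotarevENN (h : ℕ) (E F : Set ℂ) : ℝ≥0∞ :=
  ⨅ (p : Polynomial ℂ) (q : Polynomial ℂ) (_ : p.natDegree ≤ h ∧ q.natDegree ≤ h ∧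
    (∀ z ∈ E, q.eval z ≠ 0) ∧ (∀ z ∈ F, p.eval z ≠ 0)), zolotarevRatio p q E F

/-- The Zolotarev number is at most `1`, as the competitor `g = 1` shows. -/
theorem zolotarevENN_le_one (h : ℕ) (E F : Set ℂ) : zolotarevENN h E F ≤ 1 := by
  refine (iInf₂_le (1 : Polynomial ℂ) (1 : Polynomial ℂ)).trans
    ((iInf_le _ ⟨by simp, by simp, by simp, by simp⟩).trans ?_)
  refine ENNReal.div_le_of_le_mul ?_
  rw [one_mul]
  refine (iSup₂_le fun z _ => ?_ : _ ≤ (1 : ℝ≥0∞)).trans (le_iInf₂ fun z _ => ?_)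
  all_goals simp [ratModulus]

/-- The Zolotarev number `Z_h(E, F)` as a real number; it is finite by `zolotarevENN_le_one`. -/
def zolotarev (h : ℕ) (E F : Set ℂ) : ℝ := (zolotarevENN h E F).toReal

/-- `|min (W(B) ∩ ℝ)|` for a real matrix `B`. -/
def tau {n : ℕ} (B : Matrix (Fin n) (Fin n) ℝ) : ℝ :=
  |sInf {x : ℝ | (x : ℂ) ∈ realNumericalRange B}|

/-- The set `W(L⁻¹ A L) + [-τ - √(τ² + ‖F‖₂ ‖Q‖₂), 0]` with `τ = |min (W(L⁻¹ A L) ∩ ℝ)|`. -/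
def setE {n : ℕ} (A F Q L : Matrix (Fin n) (Fin n) ℝ) : Set ℂ :=
  realNumericalRange (L⁻¹ * A * L) +
    Complex.ofReal '' Set.Icc
      (-tau (L⁻¹ * A * L) - Real.sqrt (tau (L⁻¹ * A * L) ^ 2 + ‖F‖ * ‖Q‖)) 0

end QSRiccati

end

/-! Congruence with `L` turns the quadratic coefficient into the identity. With K = L⁻¹, A' = KAL,
X' = LᵀXL and Q' = LᵀQL one gets A'ᵀX' + X'A' - X'² + Q' = 0. The (2,1) block of this equation says
that Y = X'₂₁ solves the Sylvester equation (A' - X')ᵀ₂₂ Y + Y (A' - X')₁₁ = -((A'ᵀ)₂₁X'₁₁ +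
X'₂₂A'₂₁ + Q'₂₁). Triangularity of `L` bounds the rank of the right-hand side by 2r_a + 3r_f + r_q
(`IsCholeskyFactor.rank_sylvester_le`). Testing the equation with a top eigenvector of X' shows that
its largest eigenvalue μ satisfies μ² ≤ ‖F‖‖Q‖. As X' is symmetric, subtracting it only shifts the
numerical range of A' along the real axis, by at most μ to the left, so it stays in E
(`star_dotProduct_closedLoop_mem_setE`). This passes to principal blocks and transposes.

For BY - YC = R and g = p/q of degree at most d, the matrix Y - g(B) Y g(C)⁻¹ has rank at most d ·
rank R (`exists_rank_le_norm_sub_le`). The error g(B) Y g(C)⁻¹ is controlled by the maxima of g and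
1/g on convex sets containing the numerical ranges, through `isSpectralConstant_five`. That bound
follows Crouzeix and Palencia: if |f| ≤ M on D and g is now the Cauchy transform of conj f, then
f(A) + g(A)* is the integral of f against a positive operator density of mass 2, so its norm is at
most 2M. The scalar case gives |g| ≤ 3M on D. Expanding f(A)f(A)* then shows that the best constant
C satisfies C² ≤ 5C. Contour integrals are replaced by area integrals against ∂̄ of a cutoff, so no
boundary regularity is needed.

The constant 5 in place of 1 + √2 costs nothing in the end, because t is twice the rank 2r_a + 3r_f
+ r_q. The square of a competitor of degree h can be used within rank ht, with relative error 25ρ²,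
where ρ is the ratio of the competitor. Put w = (1+√2)² ≥ 5. If wρ ≤ 1, then 25ρ² ≤ 5ρ ≤ wρ;
otherwise the zero approximation already suffices (`sigma_block_le_mul_mul`).

Finally X₂₁ = K₂₂ᵀ(X'₂₁K₁₁ + X'₂₂K₂₁). Undoing the congruence adds rank at most r_f, from K₂₁, and
the factor ‖K‖²‖L‖² = κ(F) (`IsCholeskyFactor.sigma_block_le`). -/

noncomputable section

namespace QSRiccati

open MeasureTheory Metric Filter Topology ComplexConjugate

/-! ### Green's formula against a cutoff. -/

section Cutoff

/-- Twice the Cauchy–Riemann operator `∂/∂z̄`, applied to a real function. -/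
def dbar (χ : ℂ → ℝ) (z : ℂ) : ℂ := fderiv ℝ χ z 1 + Complex.I * fderiv ℝ χ z Complex.I

theorem continuous_dbar {χ : ℂ → ℝ} (hχ : ContDiff ℝ 1 χ) : Continuous (dbar χ) := by
  have h := hχ.continuous_fderiv one_ne_zero
  unfold dbar
  fun_prop

theorem dbar_eq_zero_of_eventuallyEq {χ : ℂ → ℝ} {z : ℂ} {c : ℝ} (h : χ =ᶠ[𝓝 z] fun _ => c) :
    dbar χ z = 0 := by
  simp [dbar, h.fderiv_eq]

theorem dbar_sub {χ₁ χ₂ : ℂ → ℝ} (h₁ : ContDiff ℝ 1 χ₁) (h₂ : ContDiff ℝ 1 χ₂) (z : ℂ) :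
    dbar (χ₁ - χ₂) z = dbar χ₁ z - dbar χ₂ z := by
  have e : fderiv ℝ (χ₁ - χ₂) z = fderiv ℝ χ₁ z - fderiv ℝ χ₂ z :=
    fderiv_sub ((h₁.differentiable one_ne_zero) z) ((h₂.differentiable one_ne_zero) z)
  simp only [dbar, e]
  simp
  ring

theorem support_dbar_subset (χ : ℂ → ℝ) : Function.support (dbar χ) ⊆ tsupport χ := by
  intro z hz
  by_contra h
  exact hz (dbar_eq_zero_of_eventuallyEq (c := 0) (notMem_tsupport_iff_eventuallyEq.1 h))

theorem tsupport_dbar_subset (χ : ℂ → ℝ) : tsupport (dbar χ) ⊆ tsupport χ :=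
  closure_minimal (support_dbar_subset χ) (isClosed_tsupport χ)

variable {B : Type*} [NormedAddCommGroup B] [NormedSpace ℂ B]

theorem integrable_smul_of_continuousOn {c : ℂ → ℂ} (hc : Continuous c)
    (hcs : HasCompactSupport c) {U : Set ℂ} (hU : IsOpen U) (hcU : tsupport c ⊆ U)
    {R : ℂ → B} (hR : ContinuousOn R U) : Integrable (fun z => c z • R z) := by
  have hs : tsupport (fun z => c z • R z) ⊆ tsupport c := tsupport_smul_subset_left c R
  refine Continuous.integrable_of_hasCompactSupport ?_ (hcs.smul_right)
  exact (hc.continuousOn.smul hR).continuous_of_tsupport_subset hU (hs.trans hcU)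

/-- Green's formula for a holomorphic function against the gradient of a cutoff. -/
theorem integral_dbar_smul_eq_zero {χ : ℂ → ℝ} (hχ : ContDiff ℝ 1 χ)
    (hχs : HasCompactSupport χ) {U : Set ℂ} (hU : IsOpen U) (hχU : tsupport χ ⊆ U)
    {R : ℂ → B} (hR : DifferentiableOn ℂ R U) [CompleteSpace B] :
    ∫ z, dbar χ z • R z = 0 := by
  have hcont := hχ.continuous_fderiv one_ne_zero
  have hfd : ∀ v : ℂ, ∀ z ∈ U, fderiv ℝ R z v = v • deriv R z := fun v z hz => by
    have h := ((hR.differentiableAt (hU.mem_nhds hz)).hasDerivAt.hasFDerivAt.restrictScalars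
      ℝ).fderiv
    simp [h]
  have hd1 : ∀ v : ℂ, Integrable fun z => fderiv ℝ χ z v • R z := fun v => by
    have := integrable_smul_of_continuousOn (B := B) (c := fun z => (fderiv ℝ χ z v : ℂ))
      (by fun_prop) (((hχs.fderiv_apply ℝ v).comp_left (g := fun x : ℝ => (x : ℂ)) (by simp))) hU
      (((tsupport_comp_subset (g := fun x : ℝ => (x : ℂ)) (by simp) _).trans
        (tsupport_fderiv_apply_subset ℝ v)).trans hχU) hR.continuousOn
    simpa using this
  have hd2 : ∀ v : ℂ, Integrable fun z => χ z • fderiv ℝ R z v := fun v => by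
    have := integrable_smul_of_continuousOn (B := B) (c := fun z => (χ z : ℂ) * v)
      (by have := hχ.continuous; fun_prop)
      ((hχs.comp_left (g := fun x : ℝ => (x : ℂ) * v) (by simp))) hU
      ((tsupport_comp_subset (g := fun x : ℝ => (x : ℂ) * v) (by simp) _).trans hχU)
      (hR.deriv hU).continuousOn
    refine this.congr (Eventually.of_forall fun z => ?_)
    by_cases hz : z ∈ U
    · simp [hfd v z hz, mul_smul]
    · simp [image_eq_zero_of_notMem_tsupport fun h => hz (hχU h)]
  have hd3 : Integrable fun z => χ z • R z := by
    have := integrable_smul_of_continuousOn (B := B) (c := fun z => (χ z : ℂ))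
      (by have := hχ.continuous; fun_prop)
      ((hχs.comp_left (g := fun x : ℝ => (x : ℂ)) (by simp))) hU
      ((tsupport_comp_subset (g := fun x : ℝ => (x : ℂ)) (by simp) _).trans hχU)
      hR.continuousOn
    simpa using this
  -- Integration by parts in the real direction v. Since R is holomorphic, its derivative along v is
  -- v R', so the directions 1 and i contribute multiples 1 and i · i = -1 of the same integral.
  have key : ∀ v : ℂ, ∫ z, fderiv ℝ χ z v • R z = -(v • ∫ z, χ z • deriv R z) := fun v => by
    have h := integral_smul_fderiv_eq_neg_fderiv_smul_of_integrable (hd1 v) (hd2 v) hd3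
      (fun x _ => hχ.differentiable one_ne_zero x)
      (fun x hx => (hR.differentiableAt (hU.mem_nhds (hχU hx))).restrictScalars ℝ)
    rw [eq_neg_iff_add_eq_zero, add_comm, ← eq_neg_iff_add_eq_zero, ← h, ← integral_smul]
    refine integral_congr_ae (Eventually.of_forall fun z => ?_)
    by_cases hz : z ∈ U
    · simp only [hfd v z hz]
      rw [smul_comm]
    · simp [image_eq_zero_of_notMem_tsupport fun h => hz (hχU h)]
  have e : ∀ z, dbar χ z • R z
      = fderiv ℝ χ z 1 • R z + Complex.I • (fderiv ℝ χ z Complex.I • R z) := fun z => by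
    simp [dbar, add_smul, mul_smul]
  simp_rw [e]
  rw [integral_add (hd1 1) (by exact (hd1 Complex.I).smul Complex.I), integral_smul, key, key, smul_neg,
    smul_smul, Complex.I_mul_I]
  simp

/-- A monotone transition from `1` on `(-∞, a]` to `0` on `[b, ∞)`. -/
def transition (a b t : ℝ) : ℝ := Real.smoothTransition ((b - t) / (b - a))

theorem transition_eq_one {a b t : ℝ} (hab : a < b) (h : t ≤ a) : transition a b t = 1 := by
  refine Real.smoothTransition.one_of_one_le ?_
  rw [le_div_iff₀ (by linarith)]
  linarith

theorem transition_eq_zero {a b t : ℝ} (hab : a < b) (h : b ≤ t) : transition a b t = 0 := by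
  refine Real.smoothTransition.zero_of_nonpos ?_
  exact div_nonpos_of_nonpos_of_nonneg (by linarith) (by linarith)

theorem contDiff_transition (a b : ℝ) : ContDiff ℝ 1 (transition a b) := by
  unfold transition
  exact Real.smoothTransition.contDiff.comp (by fun_prop)

theorem antitone_transition {a b : ℝ} (hab : a < b) : Antitone (transition a b) := by
  intro s t hst
  refine Real.smoothTransition.monotone ?_
  have : 0 < b - a := by linarith
  gcongr

theorem deriv_transition_nonpos {a b : ℝ} (hab : a < b) (t : ℝ) : deriv (transition a b) t ≤ 0 :=
  (antitone_transition hab).deriv_nonpos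

end Cutoff

end QSRiccati
end

noncomputable section

namespace QSRiccati

open MeasureTheory Metric Filter Topology ComplexConjugate

/-! ### Cutoffs built from the distance to a convex set. -/

section Distance

/-- The metric projection onto a closed convex set: existence and variational inequality. -/
theorem exists_projection {D : Set ℂ} (hD : IsClosed D) (hc : Convex ℝ D) (hne : D.Nonempty) :
    ∃ P : ℂ → ℂ, ∀ z, P z ∈ D ∧ infDist z D = ‖z - P z‖ ∧
      ∀ v ∈ D, inner ℝ (z - P z) (v - P z) ≤ 0 := by
  have h : ∀ z : ℂ, ∃ w, w ∈ D ∧ infDist z D = ‖z - w‖ ∧ ∀ v ∈ D, inner ℝ (z - w) (v - w) ≤ 0 := by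
    intro z
    obtain ⟨w, hw, e⟩ := exists_norm_eq_iInf_of_complete_convex hne hD.isComplete hc z
    refine ⟨w, hw, ?_, (norm_eq_iInf_iff_real_inner_le_zero hc hw).1 e⟩
    rw [e, infDist_eq_iInf]
    simp [dist_eq_norm]
  choose P hP using h
  exact ⟨P, hP⟩

/-- The squared distance to a closed convex set is continuously differentiable, and its gradient
`2 N` supports the set. -/
theorem exists_hasFDerivAt_infDist_sq {D : Set ℂ} (hD : IsClosed D) (hc : Convex ℝ D)
    (hne : D.Nonempty) :
    ∃ N : ℂ → ℂ, Continuous N ∧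
      (∀ z, HasFDerivAt (fun z => infDist z D ^ 2) ((2 : ℝ) • innerSL ℝ (N z)) z) ∧
      ∀ z, ∀ v ∈ D, 0 ≤ inner ℝ (N z) (z - v) := by
  obtain ⟨P, hP⟩ := exists_projection hD hc hne
  have hlip : ∀ z w, ‖P z - P w‖ ≤ ‖z - w‖ := by
    intro z w
    have h1 := (hP z).2.2 _ (hP w).1
    have h2 := (hP w).2.2 _ (hP z).1
    have h3 : ‖P z - P w‖ ^ 2 ≤ inner ℝ (z - w) (P z - P w) := by
      have e1 : inner ℝ (z - P z) (P w - P z) = - inner ℝ (z - P z) (P z - P w) := by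
        rw [← inner_neg_right, neg_sub]
      have e2 : inner ℝ (z - w) (P z - P w) = inner ℝ (z - P z) (P z - P w)
          + inner ℝ (P z - P w) (P z - P w) - inner ℝ (w - P w) (P z - P w) := by
        rw [← inner_add_left, ← inner_sub_left]
        congr 1
        ring
      rw [← real_inner_self_eq_norm_sq]
      linarith
    have h4 := h3.trans (real_inner_le_norm _ _)
    by_contra! h
    nlinarith [norm_nonneg (z - w)]
  have hPc : Continuous P := (LipschitzWith.of_dist_le_mul (K := 1) (f := P) fun z w => by
    simpa [dist_eq_norm] using hlip z w).continuous
  have hle : ∀ z w, infDist z D ≤ ‖z - P w‖ := fun z w => by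
    rw [← dist_eq_norm]
    exact infDist_le_dist_of_mem (hP w).1
  refine ⟨fun z => z - P z, by fun_prop, fun z => ?_, fun z v hv => ?_⟩
  · refine HasFDerivAt.of_isLittleO ?_
    refine Asymptotics.IsBigO.trans_isLittleO (g := fun w => ‖w - z‖ ^ 2) ?_ ?_
    -- Each of z and w is compared with the projection of the other. The upper bound loses ‖w - z‖²
    -- once; the lower one also changes the gradient from w to z, which costs 2 · 2‖w - z‖² because
    -- P is 1-Lipschitz.
    · refine Asymptotics.IsBigO.of_bound 5 (Eventually.of_forall fun w => ?_)
      have e1 : ‖w - P z‖ ^ 2 = ‖z - P z‖ ^ 2 + 2 * inner ℝ (z - P z) (w - z) + ‖w - z‖ ^ 2 := by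
        rw [← norm_add_sq_real]
        congr 2
        ring
      have e2 : ‖z - P w‖ ^ 2 = ‖w - P w‖ ^ 2 - 2 * inner ℝ (w - P w) (w - z) + ‖w - z‖ ^ 2 := by
        rw [← norm_sub_sq_real]
        congr 2
        ring
      have h1 : infDist w D ^ 2 ≤ ‖w - P z‖ ^ 2 := by
        gcongr
        · exact infDist_nonneg
        · exact hle w z
      have h2 : infDist z D ^ 2 ≤ ‖z - P w‖ ^ 2 := by
        gcongr
        · exact infDist_nonneg
        · exact hle z w
      have h3 : |inner ℝ ((w - P w) - (z - P z)) (w - z)| ≤ 2 * ‖w - z‖ * ‖w - z‖ := by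
        refine (abs_real_inner_le_norm _ _).trans ?_
        gcongr
        have : (w - P w) - (z - P z) = (w - z) - (P w - P z) := by ring
        rw [this]
        refine (norm_sub_le _ _).trans ?_
        linarith [hlip w z]
      rw [inner_sub_left] at h3
      have h4 := abs_le.1 h3
      have hw := (hP w).2.1
      have hz := (hP z).2.1
      rw [Real.norm_of_nonneg (sq_nonneg ‖w - z‖), Real.norm_eq_abs, abs_le]
      simp only [_root_.smul_apply, innerSL_apply_apply, smul_eq_mul]
      rw [hw] at h1 ⊢
      rw [hz] at h2 ⊢
      constructor <;> nlinarith
    · have : (fun w => ‖w - z‖ ^ 2) =o[𝓝 z] fun w => ‖w - z‖ := by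
        have h : Tendsto (fun w => ‖w - z‖) (𝓝 z) (𝓝 0) := by
          have : Continuous fun w : ℂ => ‖w - z‖ := by fun_prop
          simpa using this.tendsto z
        have := (Asymptotics.isLittleO_one_iff ℝ).2 h
        simpa [pow_two] using this.mul_isBigO (Asymptotics.isBigO_refl (fun w => ‖w - z‖) (𝓝 z))
      exact this.of_norm_right
  · have h := (hP z).2.2 v hv
    have e : inner ℝ (z - P z) (z - v) = ‖z - P z‖ ^ 2 - inner ℝ (z - P z) (v - P z) := by
      rw [← real_inner_self_eq_norm_sq, ← inner_sub_right]
      congr 1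
      ring
    rw [e]
    nlinarith [sq_nonneg ‖z - P z‖]

/-- A cutoff of a compact convex set `D`: equal to `1` up to distance `r`, to `0` beyond distance
`R`, and decreasing in the directions that point away from `D`. -/
structure IsCutoff (D : Set ℂ) (r R : ℝ) (χ : ℂ → ℝ) : Prop where
  contDiff : ContDiff ℝ 1 χ
  eventually_one : ∀ z, infDist z D ≤ r → χ =ᶠ[𝓝 z] fun _ => 1
  zero : ∀ z, R ≤ infDist z D → χ z = 0
  supports : ∀ z, ∀ v ∈ D, inner ℝ (dbar χ z) (z - v) ≤ 0

theorem exists_isCutoff {D : Set ℂ} (hD : IsClosed D) (hc : Convex ℝ D) (hne : D.Nonempty)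
    {r R : ℝ} (hr : 0 ≤ r) (hR : r < R) : ∃ χ, IsCutoff D r R χ := by
  obtain ⟨N, hN, hd, hs⟩ := exists_hasFDerivAt_infDist_sq hD hc hne
  -- Starting the descent at m > r makes χ equal to 1 on a neighbourhood of every point at distance
  -- at most r.
  obtain ⟨m, hm1, hm2⟩ := exists_between hR
  have hmR : m ^ 2 < R ^ 2 := by nlinarith
  set η := transition (m ^ 2) (R ^ 2)
  have hη : ∀ t, HasDerivAt η (deriv η t) t := fun t =>
    ((contDiff_transition _ _).differentiable one_ne_zero t).hasDerivAt
  have hηc : Continuous (deriv η) := (contDiff_transition _ _).continuous_deriv le_rfl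
  set χ := fun z => η (infDist z D ^ 2)
  have hχ : ∀ z, HasFDerivAt χ (deriv η (infDist z D ^ 2) • (2 : ℝ) • innerSL ℝ (N z)) z :=
    fun z => (hη _).comp_hasFDerivAt z (hd z)
  have hcd := continuous_infDist_pt (s := D)
  refine ⟨χ, ?_, fun z hz => ?_, fun z hz => ?_, fun z v hv => ?_⟩
  · rw [contDiff_one_iff_fderiv]
    refine ⟨fun z => (hχ z).differentiableAt, ?_⟩
    have : fderiv ℝ χ = fun z => deriv η (infDist z D ^ 2) • (2 : ℝ) • innerSL ℝ (N z) :=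
      funext fun z => (hχ z).fderiv
    rw [this]
    fun_prop
  · filter_upwards [(isOpen_lt hcd continuous_const).mem_nhds (hz.trans_lt hm1)] with w hw
    refine transition_eq_one hmR ?_
    have : infDist w D < m := hw
    have := infDist_nonneg (x := w) (s := D)
    gcongr
  · exact transition_eq_zero hmR (by gcongr; linarith)
  · have e : dbar χ z = ((deriv η (infDist z D ^ 2) * 2 : ℝ) : ℂ) * N z := by
      have h1 : inner ℝ (N z) 1 = (N z).re := by simp [Complex.inner]
      have h2 : inner ℝ (N z) Complex.I = (N z).im := by simp [Complex.inner]
      rw [dbar, (hχ z).fderiv]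
      simp only [_root_.smul_apply, innerSL_apply_apply, smul_eq_mul, h1, h2]
      conv_rhs => rw [← Complex.re_add_im (N z)]
      push_cast
      ring
    rw [e, ← Complex.real_smul, real_inner_smul_left]
    have := deriv_transition_nonpos hmR (infDist z D ^ 2)
    exact mul_nonpos_of_nonpos_of_nonneg (by linarith) (hs z v hv)

variable {D : Set ℂ} {r R : ℝ} {χ : ℂ → ℝ}

theorem mem_cthickening_iff_infDist_le (hne : D.Nonempty) (hR : 0 ≤ R) {z : ℂ} :
    z ∈ cthickening R D ↔ infDist z D ≤ R := by
  rw [mem_cthickening_iff, ENNReal.le_ofReal_iff_toReal_le (infEDist_ne_top hne) hR, infDist]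

theorem IsCutoff.tsupport_subset (h : IsCutoff D r R χ) (hne : D.Nonempty) (hR : 0 ≤ R) :
    tsupport χ ⊆ cthickening R D := by
  refine closure_minimal (fun z hz => ?_) isClosed_cthickening
  rw [mem_cthickening_iff_infDist_le hne hR]
  by_contra! hlt
  exact hz (h.zero z hlt.le)

theorem IsCutoff.hasCompactSupport (h : IsCutoff D r R χ) (hD : IsCompact D) (hne : D.Nonempty)
    (hR : 0 ≤ R) : HasCompactSupport χ :=
  hD.cthickening.of_isClosed_subset (isClosed_tsupport χ) (h.tsupport_subset hne hR)

theorem IsCutoff.dbar_eq_zero (h : IsCutoff D r R χ) {z : ℂ} (hz : infDist z D ≤ r) :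
    dbar χ z = 0 :=
  dbar_eq_zero_of_eventuallyEq (h.eventually_one z hz)

end Distance

end QSRiccati
end

noncomputable section

namespace QSRiccati

open MeasureTheory Metric Filter Topology ComplexConjugate

/-! ### Cauchy's formula for the resolvent. -/

section Resolvent

variable {B : Type*} [NormedRing B] [NormedAlgebra ℂ B] [CompleteSpace B]

theorem differentiableOn_resolvent (a : B) : DifferentiableOn ℂ (resolvent a) (spectrum ℂ a)ᶜ :=
  fun z hz => (spectrum.hasDerivAt_resolvent_const_left (k := z)
    (by simpa [spectrum] using hz)).differentiableAt.differentiableWithinAt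

omit [CompleteSpace B] in
theorem sub_mul_resolvent {a : B} {z : ℂ} (hz : z ∉ spectrum ℂ a) :
    (algebraMap ℂ B z - a) * resolvent a z = 1 :=
  Ring.mul_inverse_cancel _ (spectrum.notMem_iff.1 hz)

omit [CompleteSpace B] in
theorem resolvent_mul_sub {a : B} {z : ℂ} (hz : z ∉ spectrum ℂ a) :
    resolvent a z * (algebraMap ℂ B z - a) = 1 :=
  Ring.inverse_mul_cancel _ (spectrum.notMem_iff.1 hz)

/-- The radial cutoff, equal to `1` on the disc of radius `ρ`. -/
def radialCutoff (ρ : ℝ) (z : ℂ) : ℝ := transition (ρ ^ 2) (2 * ρ ^ 2) (‖z‖ ^ 2)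

theorem contDiff_radialCutoff (ρ : ℝ) : ContDiff ℝ 1 (radialCutoff ρ) :=
  (contDiff_transition _ _).comp (contDiff_norm_sq ℝ)

theorem dbar_radialCutoff (ρ : ℝ) (z : ℂ) : dbar (radialCutoff ρ) z
    = ((deriv (transition (ρ ^ 2) (2 * ρ ^ 2)) (‖z‖ ^ 2) * 2 : ℝ) : ℂ) * z := by
  have h := (((contDiff_transition (ρ ^ 2) (2 * ρ ^ 2)).differentiable one_ne_zero
    (‖z‖ ^ 2)).hasDerivAt.comp_hasFDerivAt z (hasStrictFDerivAt_norm_sq z).hasFDerivAt).fderiv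
  change fderiv ℝ (radialCutoff ρ) z = _ at h
  have h1 : inner ℝ z 1 = z.re := by simp [Complex.inner]
  have h2 : inner ℝ z Complex.I = z.im := by simp [Complex.inner]
  rw [dbar, h]
  simp only [_root_.smul_apply, innerSL_apply_apply, smul_eq_mul, h1, h2, nsmul_eq_mul]
  generalize deriv (transition (ρ ^ 2) (2 * ρ ^ 2)) (‖z‖ ^ 2) = d
  conv_rhs => rw [← Complex.re_add_im z]
  push_cast
  ring

theorem hasCompactSupport_radialCutoff {ρ : ℝ} (hρ : 0 < ρ) :
    HasCompactSupport (radialCutoff ρ) := by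
  refine HasCompactSupport.intro (isCompact_closedBall (0 : ℂ) (2 * ρ)) fun z hz => ?_
  refine transition_eq_zero (by nlinarith) ?_
  have : 2 * ρ < ‖z‖ := by simpa using hz
  nlinarith

/-- In polar coordinates the integral is 2π times that of the derivative of y ↦ η(y²), which drops
from 1 to 0. -/
theorem integral_deriv_radialCutoff {ρ : ℝ} (hρ : 0 < ρ) :
    ∫ z : ℂ, deriv (transition (ρ ^ 2) (2 * ρ ^ 2)) (‖z‖ ^ 2) * 2 = -(2 * Real.pi) := by
  set η := transition (ρ ^ 2) (2 * ρ ^ 2)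
  have hlt : ρ ^ 2 < 2 * ρ ^ 2 := by nlinarith
  have h1 : ∫ y in Set.Ioi (0 : ℝ), y * (deriv η (y ^ 2) * 2) = 0 - 1 := by
    have e0 : η ((0 : ℝ) ^ 2) = 1 := transition_eq_one hlt (by simp; positivity)
    rw [← e0]
    refine integral_Ioi_of_hasDerivAt_of_nonpos (g := fun y : ℝ => η (y ^ 2))
      (((contDiff_transition _ _).continuous.comp (by fun_prop)).continuousWithinAt)
      (fun y _ => ?_) (fun y hy => ?_) ?_
    · have := ((contDiff_transition (ρ ^ 2) (2 * ρ ^ 2)).differentiable one_ne_zero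
        (y ^ 2)).hasDerivAt.comp y (hasDerivAt_pow 2 y)
      refine this.congr_deriv ?_
      change deriv η (y ^ 2) * (((2 : ℕ) : ℝ) * y ^ (2 - 1)) = _
      push_cast
      ring
    · have := deriv_transition_nonpos hlt (y ^ 2)
      exact mul_nonpos_of_nonneg_of_nonpos (le_of_lt hy) (by linarith)
    · refine tendsto_const_nhds.congr' ?_
      filter_upwards [eventually_ge_atTop (2 * ρ)] with y hy
      exact (transition_eq_zero hlt (by nlinarith)).symm
  have h2 := integral_fun_norm_addHaar (E := ℂ) volume (fun y : ℝ => deriv η (y ^ 2) * 2)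
  rw [h2]
  simp only [Complex.finrank_real_complex, Nat.add_one_sub_one, pow_one, smul_eq_mul, h1,
    measureReal_def, Complex.volume_ball]
  simp

theorem tsupport_dbar_subset_compl {χ : ℂ → ℝ} {S : Set ℂ}
    (ho : ∀ z ∈ S, χ =ᶠ[𝓝 z] fun _ => 1) : tsupport (dbar χ) ⊆ Sᶜ := fun z hz hza => by
  refine (notMem_tsupport_iff_eventuallyEq.2 ?_) hz
  filter_upwards [(ho z hza).eventuallyEq_nhds] with w hw
  exact dbar_eq_zero_of_eventuallyEq hw

theorem hasCompactSupport_dbar {χ : ℂ → ℝ} (hs : HasCompactSupport χ) :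
    HasCompactSupport (dbar χ) :=
  hs.of_isClosed_subset (isClosed_tsupport _) (tsupport_dbar_subset χ)

theorem integrable_dbar_smul_resolvent {χ : ℂ → ℝ} (h : ContDiff ℝ 1 χ)
    (hs : HasCompactSupport χ) {a : B} (ho : ∀ z ∈ spectrum ℂ a, χ =ᶠ[𝓝 z] fun _ => 1) :
    Integrable fun z => dbar χ z • resolvent a z :=
  integrable_smul_of_continuousOn (continuous_dbar h) (hasCompactSupport_dbar hs)
    (spectrum.isClosed a).isOpen_compl (tsupport_dbar_subset_compl ho)
    (differentiableOn_resolvent a).continuousOn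

/-- The difference of the two cutoffs is supported off the spectrum, where the resolvent is
holomorphic, so Green's formula kills it. -/
theorem integral_dbar_smul_resolvent_eq {χ₁ χ₂ : ℂ → ℝ} (h₁ : ContDiff ℝ 1 χ₁)
    (h₂ : ContDiff ℝ 1 χ₂) (hs₁ : HasCompactSupport χ₁) (hs₂ : HasCompactSupport χ₂) {a : B}
    (ho₁ : ∀ z ∈ spectrum ℂ a, χ₁ =ᶠ[𝓝 z] fun _ => 1)
    (ho₂ : ∀ z ∈ spectrum ℂ a, χ₂ =ᶠ[𝓝 z] fun _ => 1) :
    ∫ z, dbar χ₁ z • resolvent a z = ∫ z, dbar χ₂ z • resolvent a z := by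
  have hopen : IsOpen (spectrum ℂ a)ᶜ := (spectrum.isClosed a).isOpen_compl
  have h0 := integral_dbar_smul_eq_zero (h₁.sub h₂) (hs₁.sub hs₂) hopen (fun z hz hza => by
    refine (notMem_tsupport_iff_eventuallyEq.2 ?_) hz
    filter_upwards [ho₁ z hza, ho₂ z hza] with w hw1 hw2
    simp [hw1, hw2]) (differentiableOn_resolvent a)
  rw [← sub_eq_zero, ← integral_sub (integrable_dbar_smul_resolvent h₁ hs₁ ho₁)
    (integrable_dbar_smul_resolvent h₂ hs₂ ho₂), ← h0]
  refine integral_congr_ae (Eventually.of_forall fun z => ?_)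
  simp only [← sub_smul]
  rw [← dbar_sub h₁ h₂]
  rfl

/-- Cauchy's integral formula for the unit, with the contour replaced by the gradient of a
cutoff. -/
theorem integral_dbar_smul_resolvent {χ : ℂ → ℝ} (h : ContDiff ℝ 1 χ)
    (hs : HasCompactSupport χ) {a : B} (ho : ∀ z ∈ spectrum ℂ a, χ =ᶠ[𝓝 z] fun _ => 1) :
    ∫ z, dbar χ z • resolvent a z = (-(2 * Real.pi) : ℂ) • (1 : B) := by
  rw [← sub_eq_zero, ← norm_le_zero_iff]
  refine le_of_forall_pos_le_add fun ε hε => ?_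
  rw [zero_add]
  -- The density m below has total mass 2π in absolute value, so the remainder is at most 2π‖a‖δ ≤
  -- ε. The summand 1 keeps δ positive when a = 0.
  set δ := ε / (2 * Real.pi * (‖a‖ + 1)) with hδ
  have hpi := Real.pi_pos
  have hδ0 : 0 < δ := by positivity
  have hev : ∀ᶠ z : ℂ in Bornology.cobounded ℂ, ‖resolvent a z‖ < δ := by
    have := (spectrum.resolvent_tendsto_cobounded (𝕜 := ℂ) a).norm
    rw [norm_zero] at this
    exact this.eventually_lt_const hδ0
  obtain ⟨s, -, hsub⟩ := (hasBasis_cobounded_norm (E := ℂ)).mem_iff.1 hev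
  obtain ⟨t, ht⟩ := (spectrum.isBounded (𝕜 := ℂ) a).subset_closedBall (0 : ℂ)
  set ρ := max (max s (t + 1)) 1
  have hρ : 0 < ρ := lt_max_of_lt_right one_pos
  have hlt : ρ ^ 2 < 2 * ρ ^ 2 := by nlinarith
  have hone : ∀ z ∈ spectrum ℂ a, radialCutoff ρ =ᶠ[𝓝 z] fun _ => 1 := fun z hz => by
    have h1 : ‖z‖ ≤ t := by simpa using ht hz
    have h2 : ‖z‖ < ρ := by
      have := (le_max_right s (t + 1)).trans (le_max_left _ (1 : ℝ))
      linarith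
    filter_upwards [(isOpen_lt continuous_norm continuous_const).mem_nhds h2] with w hw
    exact transition_eq_one hlt (by have : ‖w‖ < ρ := hw; gcongr)
  have hbig : ∀ z : ℂ, deriv (transition (ρ ^ 2) (2 * ρ ^ 2)) (‖z‖ ^ 2) ≠ 0 → ρ ≤ ‖z‖ := by
    intro z hz
    by_contra! hlt'
    refine hz ?_
    have : transition (ρ ^ 2) (2 * ρ ^ 2) =ᶠ[𝓝 (‖z‖ ^ 2)] fun _ => 1 := by
      have h3 : ‖z‖ ^ 2 < ρ ^ 2 := by gcongr
      filter_upwards [isOpen_Iio.mem_nhds h3] with w hw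
      exact transition_eq_one hlt (le_of_lt hw)
    rw [this.deriv_eq]
    simp
  set m := fun z : ℂ => deriv (transition (ρ ^ 2) (2 * ρ ^ 2)) (‖z‖ ^ 2) * 2
  have hm0 : ∀ z, m z ≤ 0 := fun z => by
    have := deriv_transition_nonpos hlt (‖z‖ ^ 2)
    simp only [m]
    linarith
  have hmI : ∫ z, m z = -(2 * Real.pi) := integral_deriv_radialCutoff hρ
  -- A non-integrable function would have integral 0, not -2π.
  have hmi : Integrable m := by
    by_contra hcon
    rw [integral_undef hcon] at hmI
    linarith
  -- The factor z in ∂̄ of the radial cutoff is absorbed by z R(z) = 1 + a R(z): the first term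
  -- yields the formula, the second is small on large circles.
  have hsplit : ∀ z, dbar (radialCutoff ρ) z • resolvent a z
      = (m z : ℂ) • (1 : B) + (m z : ℂ) • (a * resolvent a z) := fun z => by
    rw [dbar_radialCutoff]
    by_cases hz : deriv (transition (ρ ^ 2) (2 * ρ ^ 2)) (‖z‖ ^ 2) = 0
    · simp [hz, m]
    · have hza : z ∉ spectrum ℂ a := fun hza => by
        have h1 : ‖z‖ ≤ t := by simpa using ht hza
        have h2 := hbig z hz
        have := (le_max_right s (t + 1)).trans (le_max_left _ (1 : ℝ))
        linarith
      have h3 := sub_mul_resolvent hza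
      rw [sub_mul, sub_eq_iff_eq_add, ← Algebra.smul_def] at h3
      rw [mul_smul, h3, smul_add]
  have hbound : ∀ z, ‖(m z : ℂ) • (a * resolvent a z)‖ ≤ -m z * (‖a‖ * δ) := fun z => by
    rw [norm_smul, Complex.norm_real, Real.norm_eq_abs, abs_of_nonpos (hm0 z)]
    by_cases hz : deriv (transition (ρ ^ 2) (2 * ρ ^ 2)) (‖z‖ ^ 2) = 0
    · simp [hz, m]
    · have h2 := hbig z hz
      have h3 : ‖resolvent a z‖ < δ :=
        hsub (show s ≤ ‖z‖ from ((le_max_left _ _).trans (le_max_left _ _)).trans h2)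
      gcongr
      · linarith [hm0 z]
      · exact (norm_mul_le _ _).trans (by gcongr)
  have hmI' : ∫ z, (m z : ℂ) • (1 : B) = (-(2 * Real.pi) : ℂ) • (1 : B) := by
    rw [integral_smul_const, integral_complex_ofReal, hmI]
    push_cast
    rfl
  have hi1 : Integrable fun z => (m z : ℂ) • (1 : B) := hmi.ofReal.smul_const _
  have hi := integrable_dbar_smul_resolvent (contDiff_radialCutoff ρ)
    (hasCompactSupport_radialCutoff hρ) hone
  rw [integral_dbar_smul_resolvent_eq h (contDiff_radialCutoff ρ) hs
    (hasCompactSupport_radialCutoff hρ) ho hone, ← hmI', ← integral_sub hi hi1]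
  have hfin : ∫ z, -m z * (‖a‖ * δ) ≤ ε := by
    rw [integral_mul_const, integral_neg, hmI, neg_neg, hδ]
    have : 2 * Real.pi * (‖a‖ * (ε / (2 * Real.pi * (‖a‖ + 1)))) = ε * (‖a‖ / (‖a‖ + 1)) := by
      field_simp
    rw [this]
    refine mul_le_of_le_one_right hε.le ?_
    rw [div_le_one (by positivity)]
    linarith
  refine (norm_integral_le_of_norm_le (hmi.neg.mul_const (‖a‖ * δ))
    (Eventually.of_forall fun z => ?_)).trans hfin
  rw [hsplit z, add_sub_cancel_left]
  exact hbound z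

end Resolvent

end QSRiccati
end

noncomputable section

namespace QSRiccati

open MeasureTheory Metric Filter Topology ComplexConjugate Polynomial

/-! ### Rational functions of a Banach algebra element. -/

section RationalCalculus

variable {B : Type*} [NormedRing B] [NormedAlgebra ℂ B] [CompleteSpace B]

/-- The value `p(a) q(a)⁻¹` of the rational function `p / q`. -/
def ratEval (p q : ℂ[X]) (a : B) : B := aeval a p * Ring.inverse (aeval a q)

theorem isUnit_aeval {q : ℂ[X]} {a : B} (hq : ∀ z ∈ spectrum ℂ a, q.eval z ≠ 0) :
    IsUnit (aeval a q) := by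
  rcases subsingleton_or_nontrivial B with h | h
  · exact isUnit_of_subsingleton _
  · rw [← spectrum.zero_notMem_iff ℂ, spectrum.map_polynomial_aeval]
    rintro ⟨z, hz, h0⟩
    exact hq z hz h0

-- With such entire quotients for p and q, (p/q)(z) R(z) differs from R(z) (p/q)(a) by a function
-- holomorphic off the zeros of q, which Green's formula discards. Only Cauchy's formula for the
-- unit is then needed.
omit [CompleteSpace B] in
theorem exists_differentiable_quotient (a : B) (p : ℂ[X]) : ∃ Q : ℂ → B, Differentiable ℂ Q ∧
    ∀ z, algebraMap ℂ B (p.eval z) - aeval a p = (algebraMap ℂ B z - a) * Q z := by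
  induction p using Polynomial.induction_on' with
  | add p q hp hq =>
    obtain ⟨P, hP, eP⟩ := hp
    obtain ⟨Q, hQ, eQ⟩ := hq
    refine ⟨P + Q, hP.add hQ, fun z => ?_⟩
    rw [Pi.add_apply, mul_add, ← eP, ← eQ]
    simp
    abel
  | monomial n c =>
    induction n with
    | zero => exact ⟨0, differentiable_const _, fun z => by simp⟩
    | succ n ih =>
      obtain ⟨P, hP, eP⟩ := ih
      refine ⟨fun z => z • P z + aeval a (monomial n c), by fun_prop, fun z => ?_⟩
      have e : (monomial (n + 1) c : ℂ[X]) = X * monomial n c := by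
        rw [X_mul_monomial]
      rw [mul_add, mul_smul_comm, ← eP, e, map_mul, aeval_X, eval_mul, eval_X, map_mul,
        Algebra.smul_def]
      noncomm_ring

omit [CompleteSpace B] in
theorem spectrum_subset_tsupport {χ : ℂ → ℝ} {a : B}
    (ho : ∀ z ∈ spectrum ℂ a, χ =ᶠ[𝓝 z] fun _ => 1) : spectrum ℂ a ⊆ tsupport χ := fun z hz => by
  refine subset_tsupport χ ?_
  rw [Function.mem_support, (ho z hz).eq_of_nhds]
  exact one_ne_zero

/-- Cauchy's integral formula for rational functions of a Banach algebra element. -/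
theorem integral_dbar_smul_eval_smul_resolvent {χ : ℂ → ℝ} (h : ContDiff ℝ 1 χ)
    (hs : HasCompactSupport χ) {a : B} (ho : ∀ z ∈ spectrum ℂ a, χ =ᶠ[𝓝 z] fun _ => 1)
    {p q : ℂ[X]} (hq : ∀ z ∈ tsupport χ, q.eval z ≠ 0) :
    ∫ z, dbar χ z • (p.eval z / q.eval z) • resolvent a z
      = (-(2 * Real.pi) : ℂ) • ratEval p q a := by
  have hu : IsUnit (aeval a q) := isUnit_aeval fun z hz => hq z (spectrum_subset_tsupport ho hz)
  obtain ⟨P, hP, eP⟩ := exists_differentiable_quotient a p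
  obtain ⟨Q, hQ, eQ⟩ := exists_differentiable_quotient a q
  set qi := Ring.inverse (aeval a q)
  have hqi : aeval a q * qi = 1 := Ring.mul_inverse_cancel _ hu
  set R : ℂ → B := fun z => (q.eval z)⁻¹ • ((P z * aeval a q - Q z * aeval a p) * qi)
  have hU : IsOpen {z | q.eval z ≠ 0} := isOpen_ne_fun q.continuous continuous_const
  have hR : DifferentiableOn ℂ R {z | q.eval z ≠ 0} := by
    intro z hz
    have h1 : DifferentiableWithinAt ℂ (fun z => (q.eval z)⁻¹) {z | q.eval z ≠ 0} z :=
      (q.differentiable z).differentiableWithinAt.inv hz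
    have h2 : Differentiable ℂ fun z => (P z * aeval a q - Q z * aeval a p) * qi := by fun_prop
    exact h1.smul (h2 z).differentiableWithinAt
  have h0 := integral_dbar_smul_eq_zero h hs hU (fun z hz => hq z hz) hR
  have hres : ∀ z, z ∉ spectrum ℂ a → q.eval z ≠ 0 →
      (p.eval z / q.eval z) • resolvent a z = R z + resolvent a z * ratEval p q a := by
    intro z hz hqz
    have e1 : (algebraMap ℂ B z - a) * R z
        = algebraMap ℂ B (p.eval z / q.eval z) - ratEval p q a := by
      have hcomm : aeval a q * aeval a p = aeval a p * aeval a q := by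
        rw [← map_mul, ← map_mul, mul_comm]
      have e2 : (algebraMap ℂ B z - a) * R z = (q.eval z)⁻¹ •
          (((algebraMap ℂ B (p.eval z) - aeval a p) * aeval a q
            - (algebraMap ℂ B (q.eval z) - aeval a q) * aeval a p) * qi) := by
        rw [eP, eQ]
        simp only [R, mul_smul_comm]
        congr 1
        noncomm_ring
      rw [e2, sub_mul (algebraMap ℂ B (p.eval z)), sub_mul (algebraMap ℂ B (q.eval z)), hcomm,
        sub_sub_sub_cancel_right, sub_mul, mul_assoc, hqi, mul_one, smul_sub, mul_assoc,
        ← Algebra.smul_def, smul_smul, inv_mul_cancel₀ hqz, one_smul, div_eq_inv_mul, map_mul,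
        Algebra.smul_def]
      rfl
    have e3 : R z = resolvent a z * ((algebraMap ℂ B z - a) * R z) := by
      rw [← mul_assoc, resolvent_mul_sub hz, one_mul]
    rw [e3, e1, mul_sub, sub_add_cancel, Algebra.smul_def, Algebra.commutes]
  have hint1 : Integrable fun z => dbar χ z • R z :=
    integrable_smul_of_continuousOn (continuous_dbar h) (hasCompactSupport_dbar hs) hU
      (fun z hz => hq z (tsupport_dbar_subset χ hz)) hR.continuousOn
  have hts := tsupport_dbar_subset_compl ho
  have hint2 := integrable_dbar_smul_resolvent h hs ho
  have e : ∀ z, dbar χ z • (p.eval z / q.eval z) • resolvent a z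
      = dbar χ z • R z + (dbar χ z • resolvent a z) * ratEval p q a := fun z => by
    by_cases hz : dbar χ z = 0
    · simp [hz]
    · have hz' : z ∈ tsupport (dbar χ) := subset_tsupport _ hz
      rw [hres z (hts hz') (hq z (tsupport_dbar_subset χ hz')), smul_add, smul_mul_assoc]
  simp_rw [e]
  rw [integral_add hint1 (hint2.mul_const _), h0, zero_add, integral_mul_const_of_integrable hint2,
    integral_dbar_smul_resolvent h hs ho, smul_mul_assoc, one_mul]

end RationalCalculus

/-! ### Numerical ranges and positive operator densities. -/

section PositiveKernel

variable {H : Type*} [NormedAddCommGroup H] [InnerProductSpace ℂ H] [CompleteSpace H]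

omit [CompleteSpace H] in
theorem exists_inner_sub_eq {A : H →L[ℂ] H} {D : Set ℂ} (hne : D.Nonempty)
    (hW : ∀ x, ‖x‖ = 1 → inner ℂ x (A x) ∈ D) (z : ℂ) (x : H) : ∃ v ∈ D,
      inner ℂ x ((algebraMap ℂ (H →L[ℂ] H) z - A) x) = (‖x‖ : ℂ) ^ 2 * (z - v) := by
  rcases eq_or_ne x 0 with rfl | hx
  · obtain ⟨v, hv⟩ := hne
    exact ⟨v, hv, by simp⟩
  have hx' : ‖x‖ ≠ 0 := norm_ne_zero_iff.2 hx
  set u : H := (‖x‖⁻¹ : ℂ) • x with hu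
  have hun : ‖u‖ = 1 := by
    rw [hu, norm_smul]
    simp [hx']
  have e : (algebraMap ℂ (H →L[ℂ] H) z - A) x = z • x - A x := by
    simp [Algebra.algebraMap_eq_smul_one]
  have hxu : x = (‖x‖ : ℂ) • u := by
    rw [hu, smul_smul, mul_inv_cancel₀ (by exact_mod_cast hx'), one_smul]
  refine ⟨_, hW u hun, ?_⟩
  have : inner ℂ u u = (1 : ℂ) := by rw [inner_self_eq_norm_sq_to_K, hun]; simp
  rw [e]
  conv_lhs => rw [hxu]
  simp only [map_smul, inner_sub_right, inner_smul_left, inner_smul_right, this,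
    Complex.conj_ofReal]
  ring

/-- Off D the form of z - A is bounded below by dist(z, D)‖x‖², so z - A is coercive and hence
invertible. -/
theorem spectrum_subset_of_inner_mem {A : H →L[ℂ] H} {D : Set ℂ} (hD : IsClosed D)
    (hne : D.Nonempty) (hW : ∀ x, ‖x‖ = 1 → inner ℂ x (A x) ∈ D) : spectrum ℂ A ⊆ D := by
  intro z hz
  by_contra hzD
  refine hz ?_
  have hpos : 0 < infDist z D := (hD.notMem_iff_infDist_pos hne).1 hzD
  refine ContinuousLinearMap.isUnit_of_forall_le_norm_inner_map _
    (c := ⟨infDist z D, infDist_nonneg⟩) (by exact_mod_cast hpos) fun x => ?_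
  obtain ⟨v, hv, e⟩ := exists_inner_sub_eq hne hW z x
  rw [norm_inner_symm, e, norm_mul]
  simp only [norm_pow, Complex.norm_real, norm_norm]
  gcongr
  rw [← dist_eq_norm]
  exact infDist_le_dist_of_mem hv

/-- Positivity of T at x - cy, with c the phase that makes the cross term real and nonnegative. The
arithmetic mean is preferred to the geometric one because it is linear in T and can be integrated.
-/
theorem norm_inner_le_of_isPositive {T : H →L[ℂ] H} (hT : T.IsPositive) (x y : H) :
    ‖inner ℂ x (T y)‖ ≤ ((inner ℂ x (T x)).re + (inner ℂ y (T y)).re) / 2 := by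
  obtain ⟨c, hc, e⟩ : ∃ c : ℂ, ‖c‖ = 1 ∧ c * inner ℂ x (T y) = ‖inner ℂ x (T y)‖ := by
    rcases eq_or_ne (inner ℂ x (T y)) 0 with h | h
    · exact ⟨1, by simp, by simp [h]⟩
    · have h' : ‖inner ℂ x (T y)‖ ≠ 0 := norm_ne_zero_iff.2 h
      refine ⟨‖inner ℂ x (T y)‖ / inner ℂ x (T y), ?_, ?_⟩
      · simp [h']
      · field_simp
  have hpos := hT.re_inner_nonneg_right (x - c • y)
  have hsym : inner ℂ y (T x) = conj (inner ℂ x (T y)) := by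
    rw [inner_conj_symm, ← ContinuousLinearMap.adjoint_inner_left, hT.isSelfAdjoint.adjoint_eq]
  have hcc : c * conj c = 1 := by
    rw [Complex.mul_conj, Complex.normSq_eq_norm_sq, hc]; simp
  have e2 : inner ℂ (x - c • y) (T (x - c • y)) = inner ℂ x (T x) - ‖inner ℂ x (T y)‖
      - ‖inner ℂ x (T y)‖ + inner ℂ y (T y) := by
    have e3 : conj c * conj (inner ℂ x (T y)) = ‖inner ℂ x (T y)‖ := by
      rw [← map_mul, e, Complex.conj_ofReal]
    simp only [map_sub, map_smul, inner_sub_left, inner_sub_right, inner_smul_left,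
      inner_smul_right, hsym]
    linear_combination (-1 : ℂ) * e - e3 + hcc * inner ℂ y (T y)
  rw [e2] at hpos
  simp at hpos
  linarith

/-- Integrating a bounded function against a positive operator density. -/
theorem norm_integral_smul_le_of_isPositive {α : Type*} [MeasurableSpace α] {μ : Measure α}
    {T : α → H →L[ℂ] H} (hT : Integrable T μ) (hpos : ∀ z, (T z).IsPositive) {φ : α → ℂ}
    (hφ : Integrable (fun z => φ z • T z) μ) {M : ℝ} (hM : 0 ≤ M)
    (hφM : ∀ z, T z ≠ 0 → ‖φ z‖ ≤ M) :
    ‖∫ z, φ z • T z ∂μ‖ ≤ M * ‖∫ z, T z ∂μ‖ := by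
  have hin : ∀ (F : α → H →L[ℂ] H) (hF : Integrable F μ) (x y : H),
      Integrable (fun z => inner ℂ x (F z y)) μ ∧
      inner ℂ x ((∫ z, F z ∂μ) y) = ∫ z, inner ℂ x (F z y) ∂μ := fun F hF x y => by
    have h1 := ((innerSL ℂ x).comp (ContinuousLinearMap.apply ℂ H y)).integrable_comp hF
    have h2 := ((innerSL ℂ x).comp (ContinuousLinearMap.apply ℂ H y)).integral_comp_comm hF
    exact ⟨h1, h2.symm⟩
  have hbound : ∀ x y, ‖x‖ = 1 → ‖y‖ = 1 →
      ‖inner ℂ x ((∫ z, φ z • T z ∂μ) y)‖ ≤ M * ‖∫ z, T z ∂μ‖ := fun x y hx hy => by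
    have hre : ∀ u : H, ‖u‖ = 1 → Integrable (fun z => (inner ℂ u (T z u)).re) μ ∧
        ∫ z, (inner ℂ u (T z u)).re ∂μ ≤ ‖∫ z, T z ∂μ‖ := fun u hu => by
      obtain ⟨h1, h2⟩ := hin T hT u u
      refine ⟨h1.re, ?_⟩
      have h3 : ∫ z, (inner ℂ u (T z u)).re ∂μ = (inner ℂ u ((∫ z, T z ∂μ) u)).re := by
        rw [h2]
        exact integral_re h1
      rw [h3]
      refine (Complex.re_le_norm _).trans ((norm_inner_le_norm _ _).trans ?_)
      have := (∫ z, T z ∂μ).le_opNorm u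
      rw [hu] at this ⊢
      linarith
    rw [(hin _ hφ x y).2]
    refine (norm_integral_le_of_norm_le
      (g := fun z => M * (((inner ℂ x (T z x)).re + (inner ℂ y (T z y)).re) / 2)) ?_ ?_).trans ?_
    · exact (((hre x hx).1.add (hre y hy).1).div_const 2).const_mul M
    · refine Eventually.of_forall fun z => ?_
      by_cases hz : T z = 0
      · simp [hz]
      · simp only [_root_.smul_apply, inner_smul_right, norm_mul]
        exact mul_le_mul (hφM z hz) (norm_inner_le_of_isPositive (hpos z) x y) (norm_nonneg _) hM
    · rw [integral_const_mul, integral_div, integral_add (hre x hx).1 (hre y hy).1]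
      gcongr
      linarith [(hre x hx).2, (hre y hy).2]
  refine ContinuousLinearMap.opNorm_le_of_unit_norm (𝕜 := ℂ) (by positivity) fun y hy => ?_
  set v := (∫ z, φ z • T z ∂μ) y with hv
  rcases eq_or_ne v 0 with h | h
  · rw [h, norm_zero]
    positivity
  · have hvn : ‖v‖ ≠ 0 := norm_ne_zero_iff.2 h
    have h1 := hbound ((‖v‖⁻¹ : ℂ) • v) y (by rw [norm_smul]; simp [hvn]) hy
    rw [← hv, inner_smul_left, inner_self_eq_norm_sq_to_K] at h1
    have e : ‖conj (‖v‖⁻¹ : ℂ) * ((‖v‖ : ℂ)) ^ 2‖ = ‖v‖ := by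
      simp
      field_simp
    exact e.symm.le.trans h1

end PositiveKernel

end QSRiccati
end

noncomputable section

namespace QSRiccati

open MeasureTheory Metric Filter Topology ComplexConjugate Polynomial

/-! ### The Crouzeix–Palencia estimate. -/

section CauchyTransform

section Algebra

variable {B : Type*} [NormedRing B] [NormedAlgebra ℂ B] [CompleteSpace B]

theorem integrable_dbar_smul_smul_resolvent {χ : ℂ → ℝ} (h : ContDiff ℝ 1 χ)
    (hs : HasCompactSupport χ) {a : B} (ho : ∀ z ∈ spectrum ℂ a, χ =ᶠ[𝓝 z] fun _ => 1)
    {U : Set ℂ} (hU : IsOpen U) (hχU : tsupport χ ⊆ U) {g : ℂ → ℂ} (hg : ContinuousOn g U) :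
    Integrable fun z => dbar χ z • g z • resolvent a z := by
  have hts : tsupport (fun z => dbar χ z * g z) ⊆ tsupport (dbar χ) :=
    tsupport_mul_subset_left
  have hc : Continuous fun z => dbar χ z * g z :=
    ((continuous_dbar h).continuousOn.mul hg).continuous_of_tsupport_subset hU
      (hts.trans ((tsupport_dbar_subset χ).trans hχU))
  have := integrable_smul_of_continuousOn (B := B) hc
    ((hasCompactSupport_dbar hs).of_isClosed_subset (isClosed_tsupport _) hts)
    (spectrum.isClosed a).isOpen_compl (hts.trans (tsupport_dbar_subset_compl ho))
    (differentiableOn_resolvent a).continuousOn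
  simpa only [mul_smul] using this

omit [CompleteSpace B] in
theorem ratEval_mul_resolvent {a : B} {p q : ℂ[X]} (z : ℂ) :
    ratEval p q a * resolvent a z = ratEval p ((C z - X) * q) a := by
  have hcomm : Commute (aeval a (C z - X)) (aeval a q) := by
    rw [Commute, SemiconjBy, ← map_mul, ← map_mul, mul_comm]
  have e : aeval a (C z - X) = algebraMap ℂ B z - a := by simp
  rw [ratEval, ratEval, map_mul, Ring.mul_inverse_rev' hcomm, mul_assoc, e]
  rfl

end Algebra

variable {H : Type*} [NormedAddCommGroup H] [InnerProductSpace ℂ H] [CompleteSpace H]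

/-- With y = R(z)x, the form ⟨x, R(z)x⟩ is the conjugate of ⟨y, (z - A)y⟩ = ‖y‖²(z - v) for some v
in D. The cutoff decreases in the direction z - v, so c ≤ 0 gives the right sign. -/
theorem isPositive_neg_dbar_smul_resolvent {A : H →L[ℂ] H} {D : Set ℂ} (hD : IsCompact D)
    (hne : D.Nonempty) (hW : ∀ x, ‖x‖ = 1 → inner ℂ x (A x) ∈ D) {r R : ℝ} (hr : 0 ≤ r)
    {χ : ℂ → ℝ} (h : IsCutoff D r R χ) {c : ℝ} (hc : c ≤ 0) (z : ℂ) :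
    ((c : ℂ) • dbar χ z • resolvent A z
      + star ((c : ℂ) • dbar χ z • resolvent A z)).IsPositive := by
  by_cases hz : dbar χ z = 0
  · simp [hz, ContinuousLinearMap.isPositive_zero]
  have hzD : z ∉ D := fun hzD => hz (h.dbar_eq_zero (by simpa [infDist_zero_of_mem hzD] using hr))
  have hzs : z ∉ spectrum ℂ A := fun h => hzD (spectrum_subset_of_inner_mem hD.isClosed hne hW h)
  set T := (c : ℂ) • dbar χ z • resolvent A z with hT
  rw [ContinuousLinearMap.isPositive_def']
  refine ⟨IsSelfAdjoint.add_star_self T, fun x => ?_⟩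
  have e1 : ((T + star T).reApplyInnerSelf x) = 2 * (inner ℂ x (T x)).re := by
    rw [ContinuousLinearMap.reApplyInnerSelf_apply, _root_.add_apply, inner_add_left,
      ContinuousLinearMap.star_eq_adjoint, ContinuousLinearMap.adjoint_inner_left]
    have : (inner ℂ (T x) x).re = (inner ℂ x (T x)).re := inner_re_symm (𝕜 := ℂ) (T x) x
    simp only [map_add, RCLike.re_to_complex, this]
    ring
  set y := resolvent A z x with hy
  have hx : x = (algebraMap ℂ (H →L[ℂ] H) z - A) y := by
    have := congrArg (fun S : H →L[ℂ] H => S x) (sub_mul_resolvent hzs)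
    simpa using this.symm
  obtain ⟨v, hv, e2⟩ := exists_inner_sub_eq hne hW z y
  have e3 : inner ℂ x (T x) = (c * dbar χ z) * conj ((‖y‖ : ℂ) ^ 2 * (z - v)) := by
    have : T x = ((c : ℂ) * dbar χ z) • y := by
      rw [hT, hy, smul_smul]
      rfl
    rw [this, inner_smul_right, ← e2, inner_conj_symm, ← hx]
  have e4 : (inner ℂ x (T x)).re = c * ‖y‖ ^ 2 * inner ℝ (dbar χ z) (z - v) := by
    rw [e3, Complex.inner]
    simp only [map_mul, map_pow, Complex.conj_ofReal, map_sub]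
    rw [← Complex.ofReal_pow, show (c : ℂ) * dbar χ z * (((‖y‖ ^ 2 : ℝ) : ℂ) * (conj z - conj v))
      = ((c * ‖y‖ ^ 2 : ℝ) : ℂ) * (dbar χ z * (conj z - conj v)) by push_cast; ring,
      Complex.re_ofReal_mul]
    congr 1
    simp
    ring
  rw [e1, e4]
  have := h.supports z v hv
  have h2 : c * ‖y‖ ^ 2 ≤ 0 := mul_nonpos_of_nonpos_of_nonneg hc (by positivity)
  nlinarith [mul_nonneg_of_nonpos_of_nonpos h2 this]

/-- The sum of `f(A)` and of the adjoint of the Cauchy transform of `conj f` is the integral of `f`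
against a positive operator density of mass `2`. -/
theorem norm_ratEval_add_star_le {A : H →L[ℂ] H} {D : Set ℂ} (hD : IsCompact D)
    (hne : D.Nonempty) (hW : ∀ x, ‖x‖ = 1 → inner ℂ x (A x) ∈ D) {R : ℝ} (hR : 0 ≤ R)
    {χ : ℂ → ℝ} (h : IsCutoff D 0 R χ) {p q : ℂ[X]} (hq : ∀ z ∈ tsupport χ, q.eval z ≠ 0)
    {M : ℝ} (hM : 0 ≤ M) (hpq : ∀ z ∈ tsupport χ, ‖p.eval z‖ ≤ M * ‖q.eval z‖) :
    ‖ratEval p q A + star (((-(2 * Real.pi)⁻¹ : ℝ) : ℂ) •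
      ∫ z, dbar χ z • conj (p.eval z / q.eval z) • resolvent A z)‖ ≤ 2 * M := by
  set κ : ℝ := -(2 * Real.pi)⁻¹ with hκ
  have hκ0 : κ ≤ 0 := by have := Real.pi_pos; simp only [hκ, Left.neg_nonpos_iff]; positivity
  have hκ1 : (κ : ℂ) * (-(2 * Real.pi)) = 1 := by
    have : (Real.pi : ℂ) ≠ 0 := by exact_mod_cast Real.pi_ne_zero
    simp only [hκ]
    push_cast
    field_simp
  have hs := h.hasCompactSupport hD hne hR
  have ho : ∀ z ∈ spectrum ℂ A, χ =ᶠ[𝓝 z] fun _ => 1 := fun z hz =>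
    h.eventually_one z (infDist_zero_of_mem (spectrum_subset_of_inner_mem hD.isClosed hne hW hz)).le
  have hU : IsOpen {z | q.eval z ≠ 0} := isOpen_ne_fun q.continuous continuous_const
  have hf : ContinuousOn (fun z => p.eval z / q.eval z) {z | q.eval z ≠ 0} :=
    p.continuous.continuousOn.div q.continuous.continuousOn fun _ hz => hz
  have i1 := integrable_dbar_smul_resolvent h.contDiff hs ho
  have i2 := integrable_dbar_smul_smul_resolvent h.contDiff hs ho hU hq hf
  have i3 := integrable_dbar_smul_smul_resolvent h.contDiff hs ho hU hq
    (Complex.continuous_conj.comp_continuousOn hf)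
  set T : ℂ → H →L[ℂ] H := fun z => (κ : ℂ) • dbar χ z • resolvent A z
      + star ((κ : ℂ) • dbar χ z • resolvent A z) with hT
  have hstar : ∀ {F : ℂ → H →L[ℂ] H}, Integrable F → Integrable (fun z => star (F z)) := fun hF =>
    (starL' ℝ : (H →L[ℂ] H) ≃L[ℝ] (H →L[ℂ] H)).toContinuousLinearMap.integrable_comp hF
  have hstarI : ∀ F : ℂ → H →L[ℂ] H, ∫ z, star (F z) = star (∫ z, F z) := fun F =>
    (starL' ℝ : (H →L[ℂ] H) ≃L[ℝ] (H →L[ℂ] H)).integral_comp_comm F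
  have iT : Integrable T := (i1.smul (κ : ℂ)).add (hstar (i1.smul (κ : ℂ)))
  have eT : ∫ z, T z = 1 + star 1 := by
    rw [hT, integral_add (by exact i1.smul (κ : ℂ)) (by exact hstar (i1.smul (κ : ℂ))), hstarI,
      integral_smul, integral_dbar_smul_resolvent h.contDiff hs ho, smul_smul, hκ1, one_smul]
  -- A scalar f moved inside the adjoint becomes conj f. This is why the Cauchy transform of conj f
  -- appears.
  have ef : ∀ z, (p.eval z / q.eval z) • T z
      = (κ : ℂ) • dbar χ z • (p.eval z / q.eval z) • resolvent A z
      + star ((κ : ℂ) • dbar χ z • conj (p.eval z / q.eval z) • resolvent A z) := fun z => by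
    generalize p.eval z / q.eval z = f
    simp only [hT, smul_add, star_smul, smul_smul, RCLike.star_def, map_mul, Complex.conj_conj]
    congr 2 <;> ring
  have j1 : Integrable fun z => (κ : ℂ) • dbar χ z • (p.eval z / q.eval z) • resolvent A z :=
    i2.smul (κ : ℂ)
  have j2 : Integrable fun z =>
      star ((κ : ℂ) • dbar χ z • conj (p.eval z / q.eval z) • resolvent A z) :=
    hstar (i3.smul (κ : ℂ))
  have key := norm_integral_smul_le_of_isPositive iT
    (isPositive_neg_dbar_smul_resolvent hD hne hW le_rfl h hκ0)
    (φ := fun z => p.eval z / q.eval z) (by simp_rw [ef]; exact j1.add j2) hM (fun z hz => by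
      have hz' : z ∈ tsupport χ := by
        by_contra hz'
        refine hz ?_
        have : dbar χ z = 0 := by
          by_contra hd
          exact hz' (support_dbar_subset χ hd)
        simp [hT, this]
      rw [norm_div]
      exact div_le_of_le_mul₀ (norm_nonneg _) hM (hpq z hz'))
  simp_rw [ef] at key
  rw [integral_add j1 j2, hstarI, integral_smul, integral_smul,
    integral_dbar_smul_eval_smul_resolvent h.contDiff hs ho hq, smul_smul, hκ1, one_smul, eT] at key
  refine key.trans ?_
  rw [mul_comm]
  gcongr
  refine (norm_add_le _ _).trans ?_
  have h1 : ‖(1 : H →L[ℂ] H)‖ ≤ 1 := ContinuousLinearMap.norm_id_le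
  rw [star_one]
  linarith

end CauchyTransform

end QSRiccati
end

noncomputable section

namespace QSRiccati

open MeasureTheory Metric Filter Topology ComplexConjugate Polynomial

/-! ### Closure of the rational functions of an element. -/

section RationalFunctions

variable {B : Type*} [NormedRing B] [NormedAlgebra ℂ B] [CompleteSpace B]

/-- The quotient map by V kills the integrand, hence the integral; a non-integrable function has
integral 0. -/
theorem integral_mem_of_isClosed {α : Type*} [MeasurableSpace α] {μ : Measure α}
    {V : Submodule ℂ B} (hV : IsClosed (V : Set B)) {F : α → B} (hF : ∀ z, F z ∈ V) :
    ∫ z, F z ∂μ ∈ V := by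
  by_cases hi : Integrable F μ
  · have := V.mkQL.integral_comp_comm hi
    have h0 : ∀ z, V.mkQL (F z) = 0 := fun z => (Submodule.Quotient.mk_eq_zero V).2 (hF z)
    simp only [h0, integral_zero] at this
    exact (Submodule.Quotient.mk_eq_zero V).1 this.symm
  · rw [integral_undef hi]
    exact V.zero_mem

omit [CompleteSpace B] in
theorem eq_ratEval_iff {a b : B} {p q : ℂ[X]} (hq : IsUnit (aeval a q)) :
    b = ratEval p q a ↔ b * aeval a q = aeval a p :=
  Ring.eq_mul_inverse_iff_mul_eq _ _ _ hq

omit [CompleteSpace B] in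
theorem map_ratEval {B' : Type*} [NormedRing B'] [NormedAlgebra ℂ B'] (θ : B →ₐ[ℂ] B') {a : B}
    {p q : ℂ[X]} (hq : IsUnit (aeval a q)) : θ (ratEval p q a) = ratEval p q (θ a) := by
  have h : IsUnit (aeval (θ a) q) := by
    rw [aeval_algHom_apply]
    exact hq.map θ
  rw [eq_ratEval_iff h, aeval_algHom_apply, aeval_algHom_apply, ← map_mul,
    (eq_ratEval_iff hq).1 rfl]

omit [CompleteSpace B] in
theorem map_resolvent {B' : Type*} [NormedRing B'] [NormedAlgebra ℂ B'] (θ : B →ₐ[ℂ] B') {a : B}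
    {z : ℂ} (hz : z ∉ spectrum ℂ a) : θ (resolvent a z) = resolvent (θ a) z := by
  have h : z ∉ spectrum ℂ (θ a) := fun h => hz (AlgHom.spectrum_apply_subset θ a h)
  have h1 := congrArg θ (resolvent_mul_sub hz)
  rw [map_mul, map_one, map_sub, AlgHomClass.commutes] at h1
  calc θ (resolvent a z)
      = θ (resolvent a z) * ((algebraMap ℂ B' z - θ a) * resolvent (θ a) z) := by
        rw [sub_mul_resolvent h, mul_one]
    _ = resolvent (θ a) z := by rw [← mul_assoc, h1, one_mul]

/-- The values at `a` of the rational functions without poles in a set containing the spectrum. -/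
def rationalValues (a : B) (D : Set ℂ) (ha : spectrum ℂ a ⊆ D) : Submodule ℂ B where
  carrier := {b | ∃ p q : ℂ[X], (∀ z ∈ D, q.eval z ≠ 0) ∧ b = ratEval p q a}
  zero_mem' := ⟨0, 1, by simp, by simp [ratEval]⟩
  add_mem' := by
    rintro _ _ ⟨p₁, q₁, h₁, rfl⟩ ⟨p₂, q₂, h₂, rfl⟩
    have h : ∀ z ∈ D, (q₁ * q₂).eval z ≠ 0 := fun z hz => by simp [h₁ z hz, h₂ z hz]
    refine ⟨p₁ * q₂ + p₂ * q₁, q₁ * q₂, h, ?_⟩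
    rw [eq_ratEval_iff (isUnit_aeval fun z hz => h z (ha hz)), add_mul]
    nth_rewrite 2 [mul_comm q₁ q₂]
    rw [map_mul, map_mul, ← mul_assoc, ← mul_assoc,
      (eq_ratEval_iff (isUnit_aeval fun z hz => h₁ z (ha hz))).1 rfl,
      (eq_ratEval_iff (isUnit_aeval fun z hz => h₂ z (ha hz))).1 rfl]
    simp
  smul_mem' := by
    rintro c _ ⟨p, q, h, rfl⟩
    exact ⟨c • p, q, h, by simp [ratEval]⟩

/-- Multiplying p/q by the resolvent at z only adds a pole at z, and the weight c leaves only z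
outside D. The integral is a limit of combinations of such functions. -/
theorem ratEval_mul_integral_mem_closure {a : B} {D : Set ℂ} (ha : spectrum ℂ a ⊆ D)
    {p q : ℂ[X]} (hq : ∀ z ∈ D, q.eval z ≠ 0) {c : ℂ → ℂ} (hc : ∀ z ∈ D, c z = 0) (κ : ℂ) :
    ratEval p q a * κ • ∫ z, c z • resolvent a z ∈ (rationalValues a D ha).topologicalClosure := by
  set V := (rationalValues a D ha).topologicalClosure
  rw [mul_smul_comm]
  refine V.smul_mem κ ?_
  by_cases hi : Integrable fun z => c z • resolvent a z
  · rw [← integral_const_mul_of_integrable hi]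
    refine integral_mem_of_isClosed (Submodule.isClosed_topologicalClosure _) fun z => ?_
    rw [mul_smul_comm]
    by_cases hz : z ∈ D
    · rw [hc z hz, zero_smul]
      exact V.zero_mem
    · refine V.smul_mem _ (Submodule.le_topologicalClosure _ ?_)
      refine ⟨p, (C z - X) * q, fun w hw => ?_, ratEval_mul_resolvent z⟩
      have : z - w ≠ 0 := fun h => hz (by rwa [sub_eq_zero.1 h])
      simp [this, hq w hw]
  · rw [integral_undef hi, mul_zero]
    exact V.zero_mem

end RationalFunctions

/-! ### Convex sets containing the numerical range are 5-spectral. -/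

section NumericalRangeBound

variable {H : Type} [NormedAddCommGroup H] [InnerProductSpace ℂ H] [CompleteSpace H]

/-- `‖f(A)‖ ≤ C max_D |f|` for the rational functions `f` without poles in `D`. -/
def IsSpectralConstant (A : H →L[ℂ] H) (D : Set ℂ) (C : ℝ) : Prop :=
  ∀ p q : ℂ[X], (∀ z ∈ D, q.eval z ≠ 0) → ∀ M, 0 ≤ M →
    (∀ z ∈ D, ‖p.eval z‖ ≤ M * ‖q.eval z‖) → ‖ratEval p q A‖ ≤ C * M

/-- The thickening leaves room for a cutoff that falls from 1 to 0 outside E, and Cauchy's formula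
bounds f(A) by a finite integral. Any finite constant will do: it only starts the improvement
argument. -/
theorem exists_isSpectralConstant {A : H →L[ℂ] H} {E : Set ℂ} (hE : IsCompact E)
    (hc : Convex ℝ E) (hne : E.Nonempty) (hW : ∀ x, ‖x‖ = 1 → inner ℂ x (A x) ∈ E) {δ : ℝ}
    (hδ : 0 < δ) : ∃ C, 0 ≤ C ∧ IsSpectralConstant A (cthickening δ E) C := by
  obtain ⟨χ, h⟩ := exists_isCutoff hE.isClosed hc hne le_rfl hδ
  have hs := h.hasCompactSupport hE hne hδ.le
  have ht := h.tsupport_subset hne hδ.le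
  have ho : ∀ z ∈ spectrum ℂ A, χ =ᶠ[𝓝 z] fun _ => 1 := fun z hz =>
    h.eventually_one z (infDist_zero_of_mem (spectrum_subset_of_inner_mem hE.isClosed hne hW hz)).le
  have hi := integrable_dbar_smul_resolvent h.contDiff hs ho
  refine ⟨(2 * Real.pi)⁻¹ * ∫ z, ‖dbar χ z • resolvent A z‖, by positivity,
    fun p q hq M hM hpq => ?_⟩
  have key := integral_dbar_smul_eval_smul_resolvent h.contDiff hs ho
    (p := p) fun z hz => hq z (ht hz)
  have hn := congrArg norm key
  have hpi := Real.pi_pos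
  rw [norm_smul, norm_neg, norm_mul, Complex.norm_real, Complex.norm_ofNat, Real.norm_eq_abs,
    abs_of_pos hpi] at hn
  have hle : ‖∫ z, dbar χ z • (p.eval z / q.eval z) • resolvent A z‖
      ≤ ∫ z, M * ‖dbar χ z • resolvent A z‖ := by
    refine norm_integral_le_of_norm_le (hi.norm.const_mul M) (Eventually.of_forall fun z => ?_)
    by_cases hz : z ∈ tsupport χ
    · have h1 : ‖p.eval z / q.eval z‖ ≤ M := by
        rw [norm_div]
        exact div_le_of_le_mul₀ (norm_nonneg _) hM (hpq z (ht hz))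
      rw [smul_comm, norm_smul]
      gcongr
    · have : dbar χ z = 0 := by
        by_contra hd
        exact hz (support_dbar_subset χ hd)
      simp [this]
  rw [hn, integral_const_mul] at hle
  rw [inv_mul_eq_div, div_mul_eq_mul_div, le_div_iff₀ (by positivity)]
  linarith

/-- One improvement step for spectral constants of a compact convex set that contains the numerical
range. -/
theorem IsSpectralConstant.sqrt {A : H →L[ℂ] H} {D : Set ℂ} (hD : IsCompact D)
    (hcv : Convex ℝ D) (hne : D.Nonempty) (hW : ∀ x, ‖x‖ = 1 → inner ℂ x (A x) ∈ D) {C : ℝ}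
    (hC : 0 ≤ C) (hAC : IsSpectralConstant A D C) :
    IsSpectralConstant A D (Real.sqrt (5 * C)) := by
  intro p q hq M hM hpq
  have hbound := hAC p q hq M hM hpq
  -- The cutoff lives on a neighbourhood of D, where |p/q| may exceed M slightly; ε pays for this.
  have main : ∀ ε > 0, ‖ratEval p q A‖ ^ 2
      ≤ 2 * (M + ε) * ‖ratEval p q A‖ + C * (M * (2 * (M + ε) + M)) := by
    intro ε hε
    set U : Set ℂ := {z | q.eval z ≠ 0} ∩ {z | ‖p.eval z‖ < (M + ε) * ‖q.eval z‖}
    have hU : IsOpen U := by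
      have h1 := p.continuous
      have h2 := q.continuous
      exact (isOpen_ne_fun h2 continuous_const).inter (isOpen_lt (by fun_prop) (by fun_prop))
    have hDU : D ⊆ U := fun z hz => by
      refine ⟨hq z hz, (hpq z hz).trans_lt ?_⟩
      have := norm_pos_iff.2 (hq z hz)
      gcongr
      linarith
    obtain ⟨δ, hδ, hδU⟩ := hD.exists_cthickening_subset_open hU hDU
    obtain ⟨χ, h⟩ := exists_isCutoff hD.isClosed hcv hne le_rfl hδ
    have ht : tsupport χ ⊆ U := (h.tsupport_subset hne hδ.le).trans hδU
    have hs := h.hasCompactSupport hD hne hδ.le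
    set κ : ℂ := ((-(2 * Real.pi)⁻¹ : ℝ) : ℂ)
    set c : ℂ → ℂ := fun z => dbar χ z * conj (p.eval z / q.eval z) with hcdef
    have hc0 : ∀ z ∈ D, c z = 0 := fun z hz => by
      simp [hcdef, h.dbar_eq_zero (infDist_zero_of_mem hz).le]
    -- Needed for A itself and for scalar operators on ℂ, hence stated for every Hilbert space.
    have hS : ∀ {K : Type} [NormedAddCommGroup K] [InnerProductSpace ℂ K] [CompleteSpace K]
        (T : K →L[ℂ] K), (∀ x, ‖x‖ = 1 → inner ℂ x (T x) ∈ D) →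
        ‖ratEval p q T + star (κ • ∫ z, c z • resolvent T z)‖ ≤ 2 * (M + ε) := by
      intro K _ _ _ T hT
      simp only [hcdef, mul_smul]
      exact norm_ratEval_add_star_le hD hne hT hδ.le h (fun z hz => (ht hz).1) (by linarith)
        fun z hz => (ht hz).2.le
    have : CompactSpace D := isCompact_iff_compactSpace.1 hD
    -- The coordinate function paired with A: a rational function of `a` records its values on D
    -- together with its value at A, so an inequality between the two norms passes to the closure.
    set a : C(D, ℂ) × (H →L[ℂ] H) := (⟨Subtype.val, continuous_subtype_val⟩, A)
    have hAD := spectrum_subset_of_inner_mem hD.isClosed hne hW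
    have haD : spectrum ℂ a ⊆ D := by
      intro z hz
      by_contra hzD
      refine hz (Prod.isUnit_iff.2 ⟨?_, ?_⟩)
      · rw [ContinuousMap.isUnit_iff_forall_ne_zero]
        intro w hw
        have h1 : z - (w : ℂ) = 0 := hw
        exact hzD (by rw [sub_eq_zero.1 h1]; exact w.2)
      · exact spectrum.notMem_iff.1 fun h => hzD (hAD h)
    have hua : IsUnit (aeval a q) := isUnit_aeval fun z hz => hq z (haD hz)
    set g := κ • ∫ z, c z • resolvent a z with hg
    have ho : ∀ z ∈ spectrum ℂ a, χ =ᶠ[𝓝 z] fun _ => 1 := fun z hz =>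
      h.eventually_one z (infDist_zero_of_mem (haD hz)).le
    have hi : Integrable fun z => c z • resolvent a z := by
      have h1 : ContinuousOn (fun z => conj (p.eval z / q.eval z)) U :=
        Complex.continuous_conj.comp_continuousOn
          (p.continuous.continuousOn.div q.continuous.continuousOn fun _ hz => hz.1)
      simpa only [hcdef, mul_smul] using
        integrable_dbar_smul_smul_resolvent h.contDiff hs ho hU ht h1
    have hmem : ratEval p q a * g ∈ (rationalValues a D haD).topologicalClosure :=
      ratEval_mul_integral_mem_closure haD hq hc0 κ
    have htrans : ∀ {K : Type} [NormedAddCommGroup K] [InnerProductSpace ℂ K] [CompleteSpace K]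
        (θ : (C(D, ℂ) × (H →L[ℂ] H)) →ₐ[ℂ] (K →L[ℂ] K)) (hθ : Continuous θ),
        θ g = κ • ∫ z, c z • resolvent (θ a) z := by
      intro K _ _ _ θ hθ
      have h1 := (⟨θ.toLinearMap, hθ⟩ : (C(D, ℂ) × (H →L[ℂ] H)) →L[ℂ] (K →L[ℂ] K)).integral_comp_comm hi
      rw [hg, map_smul]
      congr 1
      refine h1.symm.trans (integral_congr_ae (Eventually.of_forall fun z => ?_))
      change θ (c z • resolvent a z) = _
      rw [map_smul]
      by_cases hz : z ∈ D
      · simp [hc0 z hz]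
      · dsimp only
        rw [map_resolvent θ fun h => hz (haD h)]
    -- Evaluation at z sends `a` to multiplication by z on ℂ, with numerical range {z} inside D. The
    -- estimate |f + conj g| ≤ 2(M + ε) there bounds g.
    have hfst : ∀ z : D, ‖(ratEval p q a).1 z‖ ≤ M ∧ ‖g.1 z‖ ≤ 2 * (M + ε) + M := by
      intro z
      set θ : (C(D, ℂ) × (H →L[ℂ] H)) →ₐ[ℂ] (ℂ →L[ℂ] ℂ) := (Algebra.ofId ℂ (ℂ →L[ℂ] ℂ)).comp
        ((ContinuousMap.evalAlgHom ℂ ℂ z).comp (AlgHom.fst ℂ _ _))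
      have hθn : ∀ b, ‖θ b‖ = ‖b.1 z‖ := fun b => norm_algebraMap' (ℂ →L[ℂ] ℂ) (b.1 z)
      have hθ : Continuous θ := by
        have h1 : Continuous fun b : C(D, ℂ) × (H →L[ℂ] H) => b.1 z :=
          (continuous_eval_const z).comp continuous_fst
        exact (continuous_algebraMap ℂ (ℂ →L[ℂ] ℂ)).comp h1
      have hθa : ∀ x : ℂ, ‖x‖ = 1 → inner ℂ x (θ a x) ∈ D := fun x hx => by
        have h1 : θ a x = (z : ℂ) * x := rfl
        have h2 : inner ℂ x (θ a x) = (z : ℂ) := by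
          rw [h1, RCLike.inner_apply, mul_assoc, RCLike.mul_conj, hx]
          simp
        rw [h2]
        exact z.2
      have h1 := hS (θ a) hθa
      rw [← htrans θ hθ, ← map_ratEval θ hua] at h1
      have h2 : ‖(ratEval p q a).1 z‖ ≤ M := by
        have e : (ratEval p q a).1 z * q.eval (z : ℂ) = p.eval (z : ℂ) := by
          have e1 := congrArg ((ContinuousMap.evalAlgHom ℂ ℂ z).comp (AlgHom.fst ℂ _ _))
            ((eq_ratEval_iff (p := p) hua).1 rfl)
          rw [map_mul, ← aeval_algHom_apply, ← aeval_algHom_apply] at e1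
          exact e1
        have e2 := hpq z z.2
        rw [← e, norm_mul] at e2
        exact le_of_mul_le_mul_right e2 (norm_pos_iff.2 (hq z z.2))
      refine ⟨h2, ?_⟩
      have h3 : ‖θ g‖ ≤ ‖θ (ratEval p q a) + star (θ g)‖ + ‖θ (ratEval p q a)‖ := by
        rw [← norm_star (θ g)]
        have := norm_sub_le (θ (ratEval p q a) + star (θ g)) (θ (ratEval p q a))
        rwa [add_sub_cancel_left] at this
      rw [hθn g, hθn (ratEval p q a)] at h3
      linarith
    set θ : (C(D, ℂ) × (H →L[ℂ] H)) →ₐ[ℂ] (H →L[ℂ] H) := AlgHom.snd ℂ _ _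
    have h1 := hS A hW
    have hθa : θ a = A := rfl
    rw [← hθa, ← htrans θ continuous_snd, ← map_ratEval θ hua] at h1
    have h2 : ‖θ (ratEval p q a * g)‖ ≤ C * (M * (2 * (M + ε) + M)) := by
      have h3 : ∀ b ∈ (rationalValues a D haD).topologicalClosure, ‖b.2‖ ≤ C * ‖b.1‖ := by
        intro b hb
        have hcl : IsClosed {b : C(D, ℂ) × (H →L[ℂ] H) | ‖b.2‖ ≤ C * ‖b.1‖} :=
          isClosed_le (by fun_prop) (by fun_prop)
        refine closure_minimal (fun b hb => ?_) hcl hb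
        obtain ⟨p', q', hq', rfl⟩ := hb
        have hu' : IsUnit (aeval a q') := isUnit_aeval fun z hz => hq' z (haD hz)
        have e0 : (ratEval p' q' a).2 = ratEval p' q' A := map_ratEval θ hu'
        rw [Set.mem_ofPred_eq, e0]
        refine hAC p' q' hq' _ (norm_nonneg _) fun z hz => ?_
        have e : (ratEval p' q' a).1 ⟨z, hz⟩ * q'.eval z = p'.eval z := by
          have e1 := congrArg ((ContinuousMap.evalAlgHom ℂ ℂ (⟨z, hz⟩ : D)).comp (AlgHom.fst ℂ _ _))
            ((eq_ratEval_iff (p := p') hu').1 rfl)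
          rw [map_mul, ← aeval_algHom_apply, ← aeval_algHom_apply] at e1
          exact e1
        rw [← e, norm_mul]
        gcongr
        exact ContinuousMap.norm_coe_le_norm _ _
      refine (h3 _ hmem).trans ?_
      gcongr
      rw [ContinuousMap.norm_le _ (by positivity)]
      intro z
      rw [Prod.fst_mul, ContinuousMap.mul_apply, norm_mul]
      have := hfst z
      gcongr
      · exact this.1
      · exact this.2
    rw [← hθa, ← map_ratEval θ hua, pow_two, ← CStarRing.norm_self_mul_star]
    set F := θ (ratEval p q a)
    -- With F = f(A) and G = g(A), this is FF* = F(F + G*)* - FG. The first term is bounded by the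
    -- positive density, the second by the constant C applied to the function fg.
    have e : F * star F = F * star (F + star (θ g)) - θ (ratEval p q a * g) := by
      rw [star_add, star_star, mul_add, map_mul]
      simp [F]
    rw [e]
    refine (norm_sub_le _ _).trans (add_le_add ?_ h2)
    refine (norm_mul_le _ _).trans ?_
    rw [norm_star, mul_comm]
    gcongr
  have main' : ‖ratEval p q A‖ ^ 2 ≤ 2 * M * ‖ratEval p q A‖ + C * (M * (2 * M + M)) := by
    have hcont : Continuous fun ε : ℝ =>
        2 * (M + ε) * ‖ratEval p q A‖ + C * (M * (2 * (M + ε) + M)) := by fun_prop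
    have hlim := hcont.tendsto' 0 (2 * M * ‖ratEval p q A‖ + C * (M * (2 * M + M))) (by simp)
    refine ge_of_tendsto (hlim.mono_left (nhdsWithin_le_nhds (s := Set.Ioi (0 : ℝ)))) ?_
    filter_upwards [self_mem_nhdsWithin] with ε hε using main ε hε
  -- One factor ‖f(A)‖ is bounded by CM, so the total is 2CM² + 3CM² = 5CM².
  have h5 : ‖ratEval p q A‖ ^ 2 ≤ (Real.sqrt (5 * C) * M) ^ 2 := by
    rw [mul_pow, Real.sq_sqrt (by positivity)]
    nlinarith [mul_le_mul_of_nonneg_left hbound (show 0 ≤ 2 * M by positivity)]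
  exact (sq_le_sq₀ (norm_nonneg _) (by positivity)).1 h5

/-- If the numerical range of `A` lies in the compact convex set `E`, then `E` is a `5`-spectral set
of `A`. -/
theorem isSpectralConstant_five {A : H →L[ℂ] H} {E : Set ℂ} (hE : IsCompact E)
    (hc : Convex ℝ E) (hne : E.Nonempty) (hW : ∀ x, ‖x‖ = 1 → inner ℂ x (A x) ∈ E) :
    IsSpectralConstant A E 5 := by
  have thick : ∀ δ > 0, IsSpectralConstant A (cthickening δ E) 5 := by
    intro δ hδ
    set D := cthickening δ E
    have hsub : E ⊆ D := self_subset_cthickening E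
    have step : ∀ C, 0 ≤ C → IsSpectralConstant A D C → IsSpectralConstant A D (√(5 * C)) :=
      fun C hC => IsSpectralConstant.sqrt hE.cthickening (hc.cthickening δ) (hne.mono hsub)
        (fun x hx => hsub (hW x hx)) hC
    set S : Set ℝ := {C | 0 ≤ C ∧ IsSpectralConstant A D C}
    have hSne : S.Nonempty := exists_isSpectralConstant hE hc hne hW hδ
    have hSbdd : BddBelow S := ⟨0, fun C hC => hC.1⟩
    have h0 : 0 ≤ sInf S := le_csInf hSne fun C hC => hC.1
    have hmem : IsSpectralConstant A D (sInf S) := by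
      intro p q hq M hM hpq
      rcases hM.eq_or_lt with rfl | hM'
      · obtain ⟨C, hC⟩ := hSne
        simpa using hC.2 p q hq 0 hM hpq
      · rw [← div_le_iff₀ hM']
        refine le_csInf hSne fun C hC => ?_
        rw [div_le_iff₀ hM']
        exact hC.2 p q hq M hM hpq
    -- The infimum of the admissible constants is itself admissible, so the improvement step applies
    -- to it and forces it to be at most 5.
    have h1 : sInf S ≤ √(5 * sInf S) :=
      csInf_le hSbdd ⟨Real.sqrt_nonneg _, step _ h0 hmem⟩
    have h2 : sInf S ≤ 5 := by
      have := Real.sq_sqrt (show 0 ≤ 5 * sInf S by positivity)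
      nlinarith
    intro p q hq M hM hpq
    exact (hmem p q hq M hM hpq).trans (by gcongr)
  intro p q hq M hM hpq
  refine le_of_forall_pos_le_add fun ε hε => ?_
  set U : Set ℂ := {z | q.eval z ≠ 0} ∩ {z | ‖p.eval z‖ < (M + ε / 5) * ‖q.eval z‖}
  have hU : IsOpen U := by
    have h1 := p.continuous
    have h2 := q.continuous
    exact (isOpen_ne_fun h2 continuous_const).inter (isOpen_lt (by fun_prop) (by fun_prop))
  have hEU : E ⊆ U := fun z hz => by
    refine ⟨hq z hz, (hpq z hz).trans_lt ?_⟩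
    have := norm_pos_iff.2 (hq z hz)
    gcongr
    linarith
  obtain ⟨δ, hδ, hδU⟩ := hE.exists_cthickening_subset_open hU hEU
  have := thick δ hδ p q (fun z hz => (hδU hz).1) (M + ε / 5) (by positivity)
    fun z hz => (hδU hz).2.le
  linarith

end NumericalRangeBound

end QSRiccati
end

noncomputable section

namespace QSRiccati

open Metric Filter Topology ComplexConjugate

/-! ### Convexity of the numerical range. -/

section ToeplitzHausdorff

variable {H : Type*} [NormedAddCommGroup H] [InnerProductSpace ℂ H]

/-- A phase c makes the form real along the segment from cx to y. The segment avoids 0, since y is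
not a multiple of x, so the Rayleigh quotient runs continuously from 0 to 1 and takes the value t.
-/
theorem exists_unit_inner_eq_of_zero_one {A : H →L[ℂ] H} {x y : H} (hx : ‖x‖ = 1)
    (h0 : inner ℂ x (A x) = 0) (h1 : inner ℂ y (A y) = 1) (hy : ‖y‖ = 1) {t : ℝ}
    (ht : t ∈ Set.Icc (0 : ℝ) 1) : ∃ u : H, ‖u‖ = 1 ∧ inner ℂ u (A u) = (t : ℂ) := by
  obtain ⟨c, hc, e⟩ : ∃ c : ℂ, ‖c‖ = 1 ∧
      (c * (inner ℂ y (A x) - conj (inner ℂ x (A y)))).im = 0 := by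
    set w := inner ℂ y (A x) - conj (inner ℂ x (A y))
    rcases eq_or_ne w 0 with h | h
    · exact ⟨1, by simp, by simp [h]⟩
    · have h' : ‖w‖ ≠ 0 := norm_ne_zero_iff.2 h
      refine ⟨‖w‖ / w, by simp [h'], ?_⟩
      rw [div_mul_cancel₀ _ h]
      exact Complex.ofReal_im _
  have hc0 : c ≠ 0 := fun h => by simp [h] at hc
  set u : ℝ → H := fun s => ((1 - s : ℝ) : ℂ) • c • x + (s : ℂ) • y with hu
  have hcont : Continuous u := by
    simp only [hu]
    fun_prop
  have hne : ∀ s, u s ≠ 0 := by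
    intro s hs
    have hs0 : (s : ℂ) ≠ 0 := fun h => by
      have h2 : s = 0 := by exact_mod_cast h
      have : c • x = 0 := by simpa [hu, h2] using hs
      rcases smul_eq_zero.1 this with h | h
      · exact hc0 h
      · simp [h] at hx
    have hyx : y = (-(s : ℂ)⁻¹ * ((1 - s : ℝ) : ℂ) * c) • x := by
      have h2 : (s : ℂ) • y = -(((1 - s : ℝ) : ℂ) • c • x) := eq_neg_of_add_eq_zero_right hs
      calc y = (s : ℂ)⁻¹ • (s : ℂ) • y := by rw [smul_smul, inv_mul_cancel₀ hs0, one_smul]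
        _ = _ := by rw [h2, smul_neg, smul_smul, smul_smul, ← neg_smul]; congr 1; ring
    rw [hyx, map_smul, inner_smul_left, inner_smul_right, h0] at h1
    simp at h1
  have him : ∀ s, (inner ℂ (u s) (A (u s))).im = 0 := by
    intro s
    have e1 : inner ℂ (u s) (A (u s)) = (((1 - s) * s : ℝ) : ℂ) * (conj c * inner ℂ x (A y)
        + c * inner ℂ y (A x)) + ((s ^ 2 : ℝ) : ℂ) := by
      simp only [hu, map_add, map_smul, inner_add_left, inner_add_right, inner_smul_left,
        inner_smul_right, h0, h1, Complex.conj_ofReal]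
      push_cast
      ring
    have e2 : (conj c * inner ℂ x (A y) + c * inner ℂ y (A x)).im = 0 := by
      rw [mul_sub, Complex.sub_im] at e
      have : (conj c * inner ℂ x (A y)).im = -(c * conj (inner ℂ x (A y))).im := by
        rw [← Complex.conj_im, map_mul, Complex.conj_conj]
      rw [Complex.add_im, this]
      linarith
    rw [e1, Complex.add_im, Complex.im_ofReal_mul, e2, Complex.ofReal_im]
    simp
  set f : ℝ → ℝ := fun s => (inner ℂ (u s) (A (u s))).re / ‖u s‖ ^ 2 with hf
  have hfc : Continuous f := by
    refine Continuous.div ?_ (by fun_prop) fun s => pow_ne_zero _ (norm_ne_zero_iff.2 (hne s))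
    exact Complex.continuous_re.comp (hcont.inner (A.continuous.comp hcont))
  have hf0 : f 0 = 0 := by
    simp [hf, hu, h0]
  have hf1 : f 1 = 1 := by
    simp [hf, hu, h1, hy]
  obtain ⟨s, -, hs⟩ := intermediate_value_Icc zero_le_one hfc.continuousOn
    (by rw [hf0, hf1]; exact ht : t ∈ Set.Icc (f 0) (f 1))
  have hn : ‖u s‖ ≠ 0 := norm_ne_zero_iff.2 (hne s)
  refine ⟨(‖u s‖⁻¹ : ℂ) • u s, by rw [norm_smul]; simp [hn], ?_⟩
  have e3 : inner ℂ (u s) (A (u s)) = ((t * ‖u s‖ ^ 2 : ℝ) : ℂ) := by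
    apply Complex.ext
    · rw [Complex.ofReal_re, ← hs, hf]
      field_simp
    · rw [him, Complex.ofReal_im]
  have hn' : (‖u s‖ : ℂ) ≠ 0 := by exact_mod_cast hn
  rw [map_smul, inner_smul_left, inner_smul_right, e3, ← Complex.ofReal_inv, Complex.conj_ofReal]
  push_cast
  field_simp

/-- The Toeplitz–Hausdorff theorem. -/
theorem convex_setOf_inner (A : H →L[ℂ] H) :
    Convex ℝ {z : ℂ | ∃ x, ‖x‖ = 1 ∧ inner ℂ x (A x) = z} := by
  rintro _ ⟨x, hx, rfl⟩ _ ⟨y, hy, rfl⟩ a b ha hb hab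
  set α := inner ℂ x (A x)
  set β := inner ℂ y (A y)
  rcases eq_or_ne α β with h | h
  · exact ⟨x, hx, by rw [← h, ← add_smul, hab, one_smul]⟩
  have hne : β - α ≠ 0 := sub_ne_zero.2 h.symm
  set B : H →L[ℂ] H := (β - α)⁻¹ • (A - α • ContinuousLinearMap.id ℂ H)
  have hB : ∀ v : H, ‖v‖ = 1 → inner ℂ v (B v) = (β - α)⁻¹ * (inner ℂ v (A v) - α) := by
    intro v hv
    simp only [B, smul_apply, sub_apply, ContinuousLinearMap.id_apply, inner_smul_right,
      inner_sub_right, inner_self_eq_norm_sq_to_K, hv]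
    simp
  obtain ⟨u, hu, e⟩ := exists_unit_inner_eq_of_zero_one (A := B) hx
    (by rw [hB x hx, sub_self, mul_zero]) (by rw [hB y hy, inv_mul_cancel₀ hne]) hy
    (t := b) ⟨hb, by linarith⟩
  refine ⟨u, hu, ?_⟩
  rw [hB u hu, inv_mul_eq_iff_eq_mul₀ hne] at e
  have ea : (a : ℂ) = 1 - b := by
    rw [eq_sub_of_add_eq hab]
    push_cast
    rfl
  simp only [Complex.real_smul]
  linear_combination e + (-α) * ea

end ToeplitzHausdorff

/-! ### Compactness and convexity of the set E. -/

section NumericalRange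

variable {n : ℕ}

theorem star_dotProduct_mulVec_eq_inner {ι : Type*} [Fintype ι] [DecidableEq ι]
    (B : Matrix ι ι ℂ) (x : EuclideanSpace ℂ ι) : star x.ofLp ⬝ᵥ (B *ᵥ x.ofLp)
      = inner ℂ x (Matrix.toEuclideanCLM (𝕜 := ℂ) B x) := by
  rw [EuclideanSpace.inner_eq_star_dotProduct, dotProduct_comm, Matrix.ofLp_toEuclideanCLM]

theorem numericalRange_eq (B : Matrix (Fin n) (Fin n) ℂ) : numericalRange B
    = {z : ℂ | ∃ x, ‖x‖ = 1 ∧ inner ℂ x (Matrix.toEuclideanCLM (𝕜 := ℂ) B x) = z} := by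
  simp only [numericalRange, star_dotProduct_mulVec_eq_inner]
  ext z
  exact exists_congr fun x => and_congr_right fun _ => eq_comm

theorem convex_numericalRange (B : Matrix (Fin n) (Fin n) ℂ) : Convex ℝ (numericalRange B) := by
  rw [numericalRange_eq]
  exact convex_setOf_inner _

theorem isCompact_numericalRange (B : Matrix (Fin n) (Fin n) ℂ) :
    IsCompact (numericalRange B) := by
  have e : numericalRange B
      = (fun x => inner ℂ x (Matrix.toEuclideanCLM (𝕜 := ℂ) B x)) '' sphere 0 1 := by
    rw [numericalRange_eq]
    ext z
    simp
  rw [e]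
  exact (isCompact_sphere _ _).image
    (continuous_id.inner (Matrix.toEuclideanCLM (𝕜 := ℂ) B).continuous)

theorem nonempty_numericalRange [NeZero n] (B : Matrix (Fin n) (Fin n) ℂ) :
    (numericalRange B).Nonempty :=
  ⟨_, EuclideanSpace.single 0 1, by simp, rfl⟩

variable (A F Q L : Matrix (Fin n) (Fin n) ℝ)

theorem convex_setE : Convex ℝ (setE A F Q L) :=
  (convex_numericalRange _).add ((convex_Icc _ _).linear_image Complex.ofRealCLM.toLinearMap)

theorem isCompact_setE : IsCompact (setE A F Q L) :=
  (isCompact_numericalRange _).add (isCompact_Icc.image Complex.continuous_ofReal)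

theorem nonempty_setE [NeZero n] : (setE A F Q L).Nonempty := by
  refine (nonempty_numericalRange _).add (Set.Nonempty.image _ ⟨0, ?_, le_rfl⟩)
  have : 0 ≤ tau (L⁻¹ * A * L) := abs_nonneg _
  have := Real.sqrt_nonneg (tau (L⁻¹ * A * L) ^ 2 + ‖F‖ * ‖Q‖)
  linarith

end NumericalRange

end QSRiccati
end

noncomputable section

namespace QSRiccati

open Polynomial

/-! ### Rank inequalities. -/

section Rank

variable {ι κ : Type*} [Fintype ι] [Fintype κ]

omit [Fintype ι] in
theorem rank_add_le {K : Type*} [Field K] (A B : Matrix ι κ K) :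
    (A + B).rank ≤ A.rank + B.rank := by
  unfold Matrix.rank
  rw [Matrix.mulVecLin_add]
  refine (Submodule.finrank_mono ?_).trans (Submodule.finrank_add_le_finrank_add_finrank _ _)
  exact LinearMap.range_add_le _ _

omit [Fintype ι] in
theorem rank_neg {K : Type*} [Field K] (A : Matrix ι κ K) : (-A).rank = A.rank := by
  unfold Matrix.rank
  have : (-A).mulVecLin = -A.mulVecLin := by
    ext
    simp
  rw [this, LinearMap.range_neg]

omit [Fintype ι] in
theorem rank_sum_le {K : Type*} [Field K] {d r : ℕ} (M : ℕ → Matrix ι κ K)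
    (hM : ∀ m, (M m).rank ≤ r) : (∑ m ∈ Finset.range d, M m).rank ≤ d * r := by
  induction d with
  | zero => simp
  | succ d ih =>
    rw [Finset.sum_range_succ, Nat.succ_mul]
    exact (rank_add_le _ _).trans (add_le_add ih (hM d))

/-- A real factorization through a space of dimension `M.rank` survives complexification. -/
theorem rank_map_ofReal_le (M : Matrix ι κ ℝ) : (M.map Complex.ofReal).rank ≤ M.rank := by
  set V := Submodule.span ℝ (Set.range M.col)
  have hV : Module.finrank ℝ V = M.rank := M.rank_eq_finrank_span_cols.symm
  let b := Module.finBasisOfFinrankEq ℝ V hV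
  have hmem : ∀ j, M.col j ∈ V := fun j => Submodule.subset_span ⟨j, rfl⟩
  let U : Matrix ι (Fin M.rank) ℝ := fun i k => (b k : ι → ℝ) i
  let N : Matrix (Fin M.rank) κ ℝ := fun k j => b.repr ⟨M.col j, hmem j⟩ k
  have hUN : M = U * N := by
    ext i j
    have h := congrArg (fun v : V => (v : ι → ℝ) i) (b.sum_repr ⟨M.col j, hmem j⟩)
    simp only [AddSubmonoidClass.coe_finsetSum, Finset.sum_apply, SetLike.val_smul, Pi.smul_apply,
      smul_eq_mul] at h
    rw [Matrix.mul_apply]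
    refine h.symm.trans (Finset.sum_congr rfl fun k _ => mul_comm _ _)
  have h2 : M.map Complex.ofReal = U.map Complex.ofReal * N.map Complex.ofReal := by
    conv_lhs => rw [hUN]
    exact Matrix.map_mul (f := Complex.ofRealHom)
  rw [h2]
  refine (Matrix.rank_mul_le_left _ _).trans ?_
  simpa using Matrix.rank_le_card_width (U.map Complex.ofReal)

end Rank

/-! ### Low-rank approximation for Sylvester equations. -/

section Sylvester

variable {ι κ : Type} [Fintype ι] [Fintype κ] [DecidableEq ι] [DecidableEq κ]

/-- The matrices `∑_{m < d} Bᵐ R Nₘ`. -/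
def krylovSpan (B : Matrix ι ι ℂ) (R : Matrix ι κ ℂ) (d : ℕ) : Submodule ℂ (Matrix ι κ ℂ) where
  carrier := {D | ∃ N : ℕ → Matrix κ κ ℂ, D = ∑ m ∈ Finset.range d, B ^ m * R * N m}
  zero_mem' := ⟨0, by simp⟩
  add_mem' := by
    rintro _ _ ⟨N₁, rfl⟩ ⟨N₂, rfl⟩
    exact ⟨N₁ + N₂, by simp [Matrix.mul_add, Finset.sum_add_distrib]⟩
  smul_mem' := by
    rintro c _ ⟨N, rfl⟩
    exact ⟨c • N, by simp [Finset.smul_sum]⟩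

omit [DecidableEq κ] in
theorem rank_le_of_mem_krylovSpan {B : Matrix ι ι ℂ} {R D : Matrix ι κ ℂ} {d : ℕ}
    (hD : D ∈ krylovSpan B R d) : D.rank ≤ d * R.rank := by
  obtain ⟨N, rfl⟩ := hD
  exact rank_sum_le _ fun m => (Matrix.rank_mul_le_left _ _).trans (Matrix.rank_mul_le_right _ _)

omit [DecidableEq κ] in
theorem pow_mul_mul_mem_krylovSpan (B : Matrix ι ι ℂ) (R : Matrix ι κ ℂ) {d m : ℕ} (hm : m < d)
    (N : Matrix κ κ ℂ) : B ^ m * R * N ∈ krylovSpan B R d := by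
  refine ⟨fun k => if k = m then N else 0, ?_⟩
  rw [Finset.sum_eq_single m] <;> simp +contextual
  omega

theorem pow_mul_sub_mul_pow {B : Matrix ι ι ℂ} {C : Matrix κ κ ℂ} {Y R : Matrix ι κ ℂ}
    (h : B * Y - Y * C = R) (k : ℕ) :
    B ^ k * Y - Y * C ^ k = ∑ l ∈ Finset.range k, B ^ l * R * C ^ (k - 1 - l) := by
  induction k with
  | zero => simp
  | succ k ih =>
    have e : B ^ (k + 1) * Y - Y * C ^ (k + 1) = (B ^ k * Y - Y * C ^ k) * C + B ^ k * R := by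
      rw [← h, pow_succ, pow_succ, Matrix.sub_mul, Matrix.mul_sub]
      simp only [Matrix.mul_assoc]
      abel
    rw [e, ih, Finset.sum_range_succ, Matrix.sum_mul]
    congr 1
    · refine Finset.sum_congr rfl fun l hl => ?_
      have : k + 1 - 1 - l = k - 1 - l + 1 := by have := Finset.mem_range.1 hl; omega
      simp only [this, pow_succ, Matrix.mul_assoc]
    · simp

/-- The smaller power factors out on both sides and leaves a telescoping difference, so only left
powers of B below max(i, j) occur. -/
theorem pow_mul_mul_pow_sub_mem_krylovSpan {B : Matrix ι ι ℂ} {C : Matrix κ κ ℂ}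
    {Y R : Matrix ι κ ℂ} (h : B * Y - Y * C = R) {i j d : ℕ} (hi : i ≤ d) (hj : j ≤ d) :
    B ^ i * Y * C ^ j - B ^ j * Y * C ^ i ∈ krylovSpan B R d := by
  wlog hij : j ≤ i generalizing i j
  · rw [← neg_sub]
    exact Submodule.neg_mem _ (this hj hi (by omega))
  obtain ⟨k, rfl⟩ := Nat.exists_eq_add_of_le hij
  have e : B ^ (j + k) * Y * C ^ j - B ^ j * Y * C ^ (j + k)
      = B ^ j * (B ^ k * Y - Y * C ^ k) * C ^ j := by
    rw [pow_add, pow_add, (Commute.pow_pow_self C j k).eq]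
    simp only [Matrix.mul_sub, Matrix.sub_mul, Matrix.mul_assoc]
  rw [e, pow_mul_sub_mul_pow h, Matrix.mul_sum, Matrix.sum_mul]
  refine Submodule.sum_mem _ fun l hl => ?_
  have e2 : B ^ j * (B ^ l * R * C ^ (k - 1 - l)) * C ^ j
      = B ^ (j + l) * R * (C ^ (k - 1 - l) * C ^ j) := by
    rw [pow_add]
    simp only [Matrix.mul_assoc]
  rw [e2]
  exact pow_mul_mul_mem_krylovSpan B R (by have := Finset.mem_range.1 hl; omega) _

/-- Both products carry the coefficient p_i q_j, so the claim reduces to monomials. Numerator and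
denominator together cost only d powers of B. -/
theorem aeval_mul_mul_aeval_sub_mem_krylovSpan {B : Matrix ι ι ℂ} {C : Matrix κ κ ℂ}
    {Y R : Matrix ι κ ℂ} (h : B * Y - Y * C = R) {p q : ℂ[X]} {d : ℕ} (hp : p.natDegree ≤ d)
    (hq : q.natDegree ≤ d) :
    aeval B p * Y * aeval C q - aeval B q * Y * aeval C p ∈ krylovSpan B R d := by
  rw [aeval_eq_sum_range' (Nat.lt_succ_of_le hp) B, aeval_eq_sum_range' (Nat.lt_succ_of_le hq) B,
    aeval_eq_sum_range' (Nat.lt_succ_of_le hp) C, aeval_eq_sum_range' (Nat.lt_succ_of_le hq) C]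
  have e : (∑ i ∈ Finset.range (d + 1), p.coeff i • B ^ i) * Y
        * (∑ j ∈ Finset.range (d + 1), q.coeff j • C ^ j)
      - (∑ j ∈ Finset.range (d + 1), q.coeff j • B ^ j) * Y
        * (∑ i ∈ Finset.range (d + 1), p.coeff i • C ^ i)
      = ∑ i ∈ Finset.range (d + 1), ∑ j ∈ Finset.range (d + 1), (p.coeff i * q.coeff j) •
        (B ^ i * Y * C ^ j - B ^ j * Y * C ^ i) := by
    simp only [Matrix.sum_mul, Matrix.mul_sum, smul_sub,
      Finset.sum_sub_distrib]
    congr 1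
    · rw [Finset.sum_comm]
      refine Finset.sum_congr rfl fun i _ => Finset.sum_congr rfl fun j _ => ?_
      simp [smul_smul, mul_comm]
    · refine Finset.sum_congr rfl fun i _ => Finset.sum_congr rfl fun j _ => ?_
      simp [smul_smul]
  rw [e]
  refine Submodule.sum_mem _ fun i hi => Submodule.sum_mem _ fun j hj => Submodule.smul_mem _ _ ?_
  exact pow_mul_mul_pow_sub_mem_krylovSpan h (by have := Finset.mem_range.1 hi; omega)
    (by have := Finset.mem_range.1 hj; omega)

theorem norm_ratEval_matrix_le {B : Matrix ι ι ℂ} {E : Set ℂ} (hE : IsCompact E)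
    (hc : Convex ℝ E) (hne : E.Nonempty)
    (hW : ∀ x : EuclideanSpace ℂ ι, ‖x‖ = 1 → star x.ofLp ⬝ᵥ (B *ᵥ x.ofLp) ∈ E) {p q : ℂ[X]}
    (hq : ∀ z ∈ E, q.eval z ≠ 0) {M : ℝ} (hM : 0 ≤ M)
    (hpq : ∀ z ∈ E, ‖p.eval z‖ ≤ M * ‖q.eval z‖) :
    IsUnit (aeval B q) ∧ ‖ratEval p q B‖ ≤ 5 * M := by
  have hW' : ∀ x : EuclideanSpace ℂ ι, ‖x‖ = 1 →
      inner ℂ x (Matrix.toEuclideanCLM (𝕜 := ℂ) B x) ∈ E := fun x hx => by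
    rw [← star_dotProduct_mulVec_eq_inner]
    exact hW x hx
  let Φ : Matrix ι ι ℂ ≃ₐ[ℂ] (EuclideanSpace ℂ ι →L[ℂ] EuclideanSpace ℂ ι) :=
    (Matrix.toEuclideanCLM (n := ι) (𝕜 := ℂ)).toAlgEquiv
  have hsp : spectrum ℂ B ⊆ E := by
    rw [← AlgEquiv.spectrum_eq Φ B]
    exact spectrum_subset_of_inner_mem hE.isClosed hne hW'
  have hu : IsUnit (aeval B q) := isUnit_aeval fun z hz => hq z (hsp hz)
  refine ⟨hu, ?_⟩
  rw [← Matrix.l2_opNorm_toEuclideanCLM]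
  have e := map_ratEval (p := p) Φ.toAlgHom hu
  exact (congrArg norm e).le.trans (isSpectralConstant_five hE hc hne hW' p q hq M hM hpq)

/-- Low-rank approximation of the solution of a Sylvester equation with a low-rank right-hand
side. -/
theorem exists_rank_le_norm_sub_le {B : Matrix ι ι ℂ} {C : Matrix κ κ ℂ} {Y R : Matrix ι κ ℂ}
    (h : B * Y - Y * C = R) {E E' : Set ℂ} (hE : IsCompact E) (hcE : Convex ℝ E)
    (hneE : E.Nonempty) (hE' : IsCompact E') (hcE' : Convex ℝ E') (hneE' : E'.Nonempty)
    (hB : ∀ x : EuclideanSpace ℂ ι, ‖x‖ = 1 → star x.ofLp ⬝ᵥ (B *ᵥ x.ofLp) ∈ E)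
    (hC : ∀ x : EuclideanSpace ℂ κ, ‖x‖ = 1 → star x.ofLp ⬝ᵥ (C *ᵥ x.ofLp) ∈ E')
    {p q : ℂ[X]} {d : ℕ} (hp : p.natDegree ≤ d) (hq : q.natDegree ≤ d)
    (hqE : ∀ z ∈ E, q.eval z ≠ 0) (hpE' : ∀ z ∈ E', p.eval z ≠ 0) {M M' : ℝ} (hM : 0 ≤ M)
    (hM' : 0 ≤ M') (hMp : ∀ z ∈ E, ‖p.eval z‖ ≤ M * ‖q.eval z‖)
    (hMq : ∀ z ∈ E', ‖q.eval z‖ ≤ M' * ‖p.eval z‖) :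
    ∃ Z : Matrix ι κ ℂ, Z.rank ≤ d * R.rank ∧ ‖Y - Z‖ ≤ 25 * (M * M') * ‖Y‖ := by
  obtain ⟨u1, n1⟩ := norm_ratEval_matrix_le hE hcE hneE hB hqE hM hMp
  obtain ⟨u2, n2⟩ := norm_ratEval_matrix_le hE' hcE' hneE' hC hpE' hM' hMq
  set D := aeval B p * Y * aeval C q - aeval B q * Y * aeval C p with hD
  have hDm := aeval_mul_mul_aeval_sub_mem_krylovSpan h hp hq
  -- Dividing D by q(B) on the left and p(C) on the right gives g(B) Y g(C)⁻¹ - Y with g = p/q. The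
  -- spectral constant 5 enters once for B and once for C, whence 25.
  refine ⟨-(Ring.inverse (aeval B q) * D * Ring.inverse (aeval C p)), ?_, ?_⟩
  · rw [rank_neg]
    exact (Matrix.rank_mul_le_left _ _).trans ((Matrix.rank_mul_le_right _ _).trans
      (rank_le_of_mem_krylovSpan hDm))
  · have e1 : Ring.inverse (aeval B q) * aeval B q = 1 := Ring.inverse_mul_cancel _ u1
    have e2 : aeval C p * Ring.inverse (aeval C p) = 1 := Ring.mul_inverse_cancel _ u2
    have e3 : Ring.inverse (aeval B q) * aeval B p = ratEval p q B := by
      rw [eq_ratEval_iff u1, mul_assoc, ← map_mul, mul_comm p q, map_mul, ← mul_assoc, e1, one_mul]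
    have e : Y - -(Ring.inverse (aeval B q) * D * Ring.inverse (aeval C p))
        = ratEval p q B * Y * ratEval q p C := by
      have e4 : Ring.inverse (aeval B q) * (aeval B p * Y * aeval C q) * Ring.inverse (aeval C p)
          = ratEval p q B * Y * ratEval q p C := by
        rw [← e3, ratEval]
        simp only [Matrix.mul_assoc]
      have e5 : Ring.inverse (aeval B q) * (aeval B q * Y * aeval C p) * Ring.inverse (aeval C p)
          = Y := by
        have : Ring.inverse (aeval B q) * (aeval B q * Y * aeval C p) * Ring.inverse (aeval C p)
          = (Ring.inverse (aeval B q) * aeval B q) * Y * (aeval C p * Ring.inverse (aeval C p)) := by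
          simp only [Matrix.mul_assoc]
        rw [this, e1, e2, Matrix.one_mul, Matrix.mul_one]
      rw [sub_neg_eq_add, hD, Matrix.mul_sub, Matrix.sub_mul, e4, e5]
      abel
    rw [e]
    calc ‖ratEval p q B * Y * ratEval q p C‖
        ≤ ‖ratEval p q B * Y‖ * ‖ratEval q p C‖ := Matrix.l2_opNorm_mul _ _
      _ ≤ (‖ratEval p q B‖ * ‖Y‖) * ‖ratEval q p C‖ := by
        gcongr
        exact Matrix.l2_opNorm_mul _ _
      _ ≤ (5 * M * ‖Y‖) * (5 * M') := by gcongr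
      _ = _ := by ring

end Sylvester

end QSRiccati
end

noncomputable section

namespace QSRiccati

/-! ### Singular values and complex low-rank approximation. -/

section SingularValues

variable {ι κ : Type} [Fintype ι] [Fintype κ] [DecidableEq ι] [DecidableEq κ]

omit [Fintype ι] [DecidableEq ι] [DecidableEq κ] in
theorem map_ofReal_mulVec (M : Matrix ι κ ℝ) (a b : κ → ℝ) :
    (M.map Complex.ofReal *ᵥ fun j => (a j + b j * Complex.I : ℂ))
      = fun i => (((M *ᵥ a) i : ℂ) + ((M *ᵥ b) i : ℂ) * Complex.I) := by
  funext i
  simp only [Matrix.mulVec, dotProduct, Matrix.map_apply]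
  push_cast
  rw [Finset.sum_mul, ← Finset.sum_add_distrib]
  exact Finset.sum_congr rfl fun j _ => by ring

omit [DecidableEq ι] [DecidableEq κ] in
theorem norm_sq_map_mulVec (M : Matrix ι κ ℝ) (a b : EuclideanSpace ℝ κ) :
    ‖WithLp.toLp 2 (M.map Complex.ofReal *ᵥ fun j => (a j + b j * Complex.I : ℂ))‖ ^ 2
      = ‖WithLp.toLp 2 (M *ᵥ a.ofLp)‖ ^ 2 + ‖WithLp.toLp 2 (M *ᵥ b.ofLp)‖ ^ 2 := by
  rw [EuclideanSpace.norm_sq_eq, EuclideanSpace.norm_sq_eq, EuclideanSpace.norm_sq_eq,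
    ← Finset.sum_add_distrib, map_ofReal_mulVec]
  refine Finset.sum_congr rfl fun i _ => ?_
  rw [Complex.sq_norm, Complex.normSq_add_mul_I]
  simp

theorem norm_sq_complex_eq (a b : EuclideanSpace ℝ κ) :
    ‖WithLp.toLp 2 fun j => (a j + b j * Complex.I : ℂ)‖ ^ 2 = ‖a‖ ^ 2 + ‖b‖ ^ 2 := by
  have := norm_sq_map_mulVec (1 : Matrix κ κ ℝ) a b
  simpa [Matrix.map_one] using this

omit [Fintype κ] [DecidableEq κ] in
theorem exists_eq_re_add_im (x : EuclideanSpace ℂ κ) : ∃ a b : EuclideanSpace ℝ κ,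
    x.ofLp = fun j => (a j + b j * Complex.I : ℂ) :=
  ⟨WithLp.toLp 2 fun j => (x j).re, WithLp.toLp 2 fun j => (x j).im,
    funext fun j => (Complex.re_add_im (x j)).symm⟩

omit [DecidableEq ι] in
theorem norm_map_ofReal_le (M : Matrix ι κ ℝ) : ‖M.map Complex.ofReal‖ ≤ ‖M‖ := by
  rw [Matrix.l2_opNorm_def (M.map Complex.ofReal)]
  refine ContinuousLinearMap.opNorm_le_bound _ (norm_nonneg _) fun x => ?_
  obtain ⟨a, b, e⟩ := exists_eq_re_add_im x
  have h1 : ‖x‖ ^ 2 = ‖a‖ ^ 2 + ‖b‖ ^ 2 := by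
    rw [← norm_sq_complex_eq a b, ← e]
  have h2 : ‖WithLp.toLp 2 (M.map Complex.ofReal *ᵥ x.ofLp)‖ ^ 2 ≤ (‖M‖ * ‖x‖) ^ 2 := by
    rw [e, norm_sq_map_mulVec, mul_pow, h1, mul_add, ← mul_pow, ← mul_pow]
    gcongr
    · exact Matrix.l2_opNorm_mulVec M a
    · exact Matrix.l2_opNorm_mulVec M b
  exact (sq_le_sq₀ (norm_nonneg _) (by positivity)).1 h2

/-- A real matrix expands the span of its leading right singular vectors. -/
theorem singularValues_mul_norm_le {V W : Type*} [NormedAddCommGroup V] [InnerProductSpace ℝ V]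
    [FiniteDimensional ℝ V] [NormedAddCommGroup W] [InnerProductSpace ℝ W]
    [FiniteDimensional ℝ W] (T : V →ₗ[ℝ] W) {r : ℕ} (hr : r < Module.finrank ℝ V) :
    ∃ v : Fin (r + 1) → V, Orthonormal ℝ v ∧ ∀ c : Fin (r + 1) → ℝ,
      (T.singularValues r) ^ 2 * ‖∑ i, c i • v i‖ ^ 2 ≤ ‖T (∑ i, c i • v i)‖ ^ 2 := by
  set S := T.adjoint ∘ₗ T
  have hS : S.IsSymmetric := T.isSymmetric_adjoint_comp_self
  set b := hS.eigenvectorBasis rfl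
  let f : Fin (r + 1) → Fin (Module.finrank ℝ V) := Fin.castLE hr
  have hf : Function.Injective f := Fin.castLE_injective hr
  have hon : Orthonormal ℝ (b ∘ f) := b.orthonormal.comp f hf
  refine ⟨b ∘ f, hon, fun c => ?_⟩
  have e1 : ‖∑ i, c i • (b ∘ f) i‖ ^ 2 = ∑ i, c i ^ 2 := by
    rw [← real_inner_self_eq_norm_sq, hon.inner_sum]
    exact Finset.sum_congr rfl fun i _ => by simp [pow_two]
  have e2 : ‖T (∑ i, c i • (b ∘ f) i)‖ ^ 2
      = ∑ i, c i ^ 2 * T.singularValues (f i) ^ 2 := by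
    rw [← real_inner_self_eq_norm_sq, ← LinearMap.adjoint_inner_right]
    have e3 : T.adjoint (T (∑ i, c i • (b ∘ f) i))
        = ∑ i, (c i * T.singularValues (f i) ^ 2) • (b ∘ f) i := by
      change S (∑ i, c i • (b ∘ f) i) = _
      rw [map_sum]
      refine Finset.sum_congr rfl fun i _ => ?_
      rw [map_smul, mul_smul]
      congr 1
      rw [T.sq_singularValues_fin rfl (f i)]
      exact hS.apply_eigenvectorBasis rfl (f i)
    rw [e3, hon.inner_sum]
    exact Finset.sum_congr rfl fun i _ => by simp; ring
  rw [e1, e2, Finset.mul_sum]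
  refine Finset.sum_le_sum fun i _ => ?_
  rw [mul_comm]
  have h1 : T.singularValues r ≤ T.singularValues (f i) :=
    T.singularValues_antitone (by simpa [f] using Nat.lt_succ_iff.1 i.2)
  have h2 := T.singularValues_nonneg r
  gcongr

omit [DecidableEq ι] in
/-- A singular value bounds from below the distance to the matrices of smaller rank, also to the
complex ones. -/
theorem sigma_le_norm_sub (M : Matrix ι κ ℝ) (Z : Matrix ι κ ℂ) {r : ℕ} (hr : Z.rank ≤ r) :
    sigma (r + 1) M ≤ ‖M.map Complex.ofReal - Z‖ := by
  set T := Matrix.toEuclideanLin M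
  rw [sigma, Nat.add_sub_cancel]
  rcases le_or_gt (Module.finrank ℝ (EuclideanSpace ℝ κ)) r with hle | hlt
  · rw [T.singularValues_of_finrank_le hle]
    exact norm_nonneg _
  obtain ⟨v, hv, hT⟩ := singularValues_mul_norm_le T hlt
  let V : Matrix κ (Fin (r + 1)) ℂ := fun j i => (v i j : ℂ)
  -- `Z * V` has r + 1 columns and rank at most r. The coefficients are complex because Z is; real
  -- and imaginary parts are then treated separately.
  obtain ⟨c, hc0, hc⟩ : ∃ c : Fin (r + 1) → ℂ, c ≠ 0 ∧ (Z * V) *ᵥ c = 0 := by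
    by_contra! hcon
    have hker : LinearMap.ker (Z * V).mulVecLin = ⊥ :=
      LinearMap.ker_eq_bot'.2 fun c hc => by
        by_contra hne
        exact hcon c hne hc
    have h1 := LinearMap.finrank_range_of_inj (LinearMap.ker_eq_bot.1 hker)
    have h2 : (Z * V).rank ≤ r := (Matrix.rank_mul_le_left _ _).trans hr
    rw [Matrix.rank, h1] at h2
    simp at h2
  set a : EuclideanSpace ℝ κ := ∑ i, (c i).re • v i with ha
  set b : EuclideanSpace ℝ κ := ∑ i, (c i).im • v i with hb
  set w : EuclideanSpace ℂ κ := WithLp.toLp 2 (V *ᵥ c)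
  have hw : w.ofLp = fun j => (a j + b j * Complex.I : ℂ) := by
    funext j
    simp only [w, Matrix.mulVec, dotProduct, V, ha, hb, WithLp.ofLp_sum, Finset.sum_apply,
      WithLp.ofLp_smul, Pi.smul_apply, smul_eq_mul]
    push_cast
    rw [Finset.sum_mul, ← Finset.sum_add_distrib]
    refine Finset.sum_congr rfl fun i _ => ?_
    conv_lhs => rw [← Complex.re_add_im (c i)]
    ring
  have hwn : ‖w‖ ^ 2 = ‖a‖ ^ 2 + ‖b‖ ^ 2 := by rw [← norm_sq_complex_eq a b, ← hw]
  have hZw : Z *ᵥ w.ofLp = 0 := by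
    rw [← hc, ← Matrix.mulVec_mulVec]
  have hw0 : w ≠ 0 := by
    intro h0
    rw [h0] at hwn
    have ha0 : a = 0 := by
      rw [← norm_eq_zero]; nlinarith [sq_nonneg ‖a‖, sq_nonneg ‖b‖, norm_zero (E := EuclideanSpace ℂ κ)]
    have hb0 : b = 0 := by
      rw [← norm_eq_zero]; nlinarith [sq_nonneg ‖a‖, sq_nonneg ‖b‖, norm_zero (E := EuclideanSpace ℂ κ)]
    have hli := Fintype.linearIndependent_iff.1 hv.linearIndependent
    refine hc0 (funext fun i => Complex.ext ?_ ?_)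
    · exact hli (fun i => (c i).re) ha0 i
    · exact hli (fun i => (c i).im) hb0 i
  have h1 : ‖WithLp.toLp 2 (M.map Complex.ofReal *ᵥ w.ofLp)‖
      ≤ ‖M.map Complex.ofReal - Z‖ * ‖w‖ := by
    have := Matrix.l2_opNorm_mulVec (M.map Complex.ofReal - Z) w
    rwa [Matrix.sub_mulVec, hZw, sub_zero] at this
  have h2 : T.singularValues r ^ 2 * ‖w‖ ^ 2
      ≤ ‖WithLp.toLp 2 (M.map Complex.ofReal *ᵥ w.ofLp)‖ ^ 2 := by
    rw [hw, norm_sq_map_mulVec, hwn, mul_add]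
    exact add_le_add (hT fun i => (c i).re) (hT fun i => (c i).im)
  have hwpos : 0 < ‖w‖ := norm_pos_iff.2 hw0
  have h3 : (T.singularValues r * ‖w‖) ^ 2 ≤ (‖M.map Complex.ofReal - Z‖ * ‖w‖) ^ 2 := by
    rw [mul_pow]
    refine h2.trans ?_
    gcongr
  have h4 := (sq_le_sq₀ (mul_nonneg (T.singularValues_nonneg r) hwpos.le) (by positivity)).1 h3
  exact le_of_mul_le_mul_right h4 hwpos

end SingularValues

end QSRiccati
end

noncomputable section

namespace QSRiccati

/-! ### Norms and quadratic forms of submatrices. -/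

section Compression

variable {𝕜 : Type*} [RCLike 𝕜] {ι κ μ : Type} [Fintype ι] [Fintype κ] [Fintype μ]
  [DecidableEq ι] [DecidableEq κ] [DecidableEq μ]

theorem norm_one_le : ‖(1 : Matrix ι ι 𝕜)‖ ≤ 1 := by
  rw [← Matrix.l2_opNorm_toEuclideanCLM, map_one]
  exact ContinuousLinearMap.norm_id_le

omit [Fintype κ] in
theorem conjTranspose_mul_one_submatrix {g : κ → ι} (hg : Function.Injective g) :
    ((1 : Matrix ι ι 𝕜).submatrix id g)ᴴ * (1 : Matrix ι ι 𝕜).submatrix id g = 1 := by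
  rw [Matrix.conjTranspose_submatrix, Matrix.conjTranspose_one,
    ← Matrix.submatrix_mul _ _ _ _ _ Function.bijective_id, Matrix.one_mul,
    Matrix.submatrix_one _ hg]

theorem norm_one_submatrix_le {g : κ → ι} (hg : Function.Injective g) :
    ‖(1 : Matrix ι ι 𝕜).submatrix id g‖ ≤ 1 := by
  have h := Matrix.l2_opNorm_conjTranspose_mul_self ((1 : Matrix ι ι 𝕜).submatrix id g)
  rw [conjTranspose_mul_one_submatrix hg] at h
  nlinarith [norm_one_le (𝕜 := 𝕜) (ι := κ), norm_nonneg ((1 : Matrix ι ι 𝕜).submatrix id g)]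

omit [Fintype κ] [Fintype μ] [DecidableEq κ] [DecidableEq μ] in
theorem submatrix_eq_mul_mul (M : Matrix ι ι 𝕜) (f : μ → ι) (g : κ → ι) : M.submatrix f g
    = ((1 : Matrix ι ι 𝕜).submatrix id f)ᴴ * M * (1 : Matrix ι ι 𝕜).submatrix id g := by
  rw [Matrix.conjTranspose_submatrix, Matrix.conjTranspose_one]
  ext i j
  simp [Matrix.mul_apply, Matrix.one_apply]

theorem norm_submatrix_le (M : Matrix ι ι 𝕜) {f : μ → ι} {g : κ → ι}
    (hf : Function.Injective f) (hg : Function.Injective g) : ‖M.submatrix f g‖ ≤ ‖M‖ := by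
  rw [submatrix_eq_mul_mul]
  refine (Matrix.l2_opNorm_mul _ _).trans ?_
  refine (mul_le_of_le_one_right (norm_nonneg _) (norm_one_submatrix_le hg)).trans ?_
  refine (Matrix.l2_opNorm_mul _ _).trans (mul_le_of_le_one_left (norm_nonneg _) ?_)
  rw [Matrix.l2_opNorm_conjTranspose]
  exact norm_one_submatrix_le hf

/-- The quadratic form of a principal submatrix is a restriction of the quadratic form. -/
theorem exists_star_dotProduct_submatrix_eq {g : κ → ι} (hg : Function.Injective g)
    (M : Matrix ι ι ℂ) (u : EuclideanSpace ℂ κ) : ∃ x : EuclideanSpace ℂ ι, ‖x‖ = ‖u‖ ∧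
      star u.ofLp ⬝ᵥ (M.submatrix g g *ᵥ u.ofLp) = star x.ofLp ⬝ᵥ (M *ᵥ x.ofLp) := by
  set P := (1 : Matrix ι ι ℂ).submatrix id g
  have key : ∀ N : Matrix ι ι ℂ, star u.ofLp ⬝ᵥ ((Pᴴ * N * P) *ᵥ u.ofLp)
      = star (P *ᵥ u.ofLp) ⬝ᵥ (N *ᵥ (P *ᵥ u.ofLp)) := fun N => by
    rw [Matrix.star_mulVec, ← Matrix.dotProduct_mulVec, Matrix.mulVec_mulVec, Matrix.mulVec_mulVec,
      Matrix.mul_assoc]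
  refine ⟨WithLp.toLp 2 (P *ᵥ u.ofLp), ?_, by rw [submatrix_eq_mul_mul]; exact key M⟩
  have h := key 1
  rw [Matrix.mul_one, conjTranspose_mul_one_submatrix hg, Matrix.one_mulVec, Matrix.one_mulVec] at h
  have hn : ∀ {α : Type} [Fintype α] (y : EuclideanSpace ℂ α),
      star y.ofLp ⬝ᵥ y.ofLp = ((‖y‖ ^ 2 : ℝ) : ℂ) := fun y => by
    rw [dotProduct_comm, ← EuclideanSpace.inner_eq_star_dotProduct, inner_self_eq_norm_sq_to_K]
    push_cast
    rfl
  have h2 := hn (WithLp.toLp 2 (P *ᵥ u.ofLp))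
  rw [← h, hn u] at h2
  have h3 : ‖WithLp.toLp 2 (P *ᵥ u.ofLp)‖ ^ 2 = ‖u‖ ^ 2 := by exact_mod_cast h2.symm
  exact (sq_eq_sq₀ (norm_nonneg _) (norm_nonneg _)).1 h3

end Compression

/-! ### Block multiplication and quasiseparable ranks. -/

section Blocks

variable {n : ℕ}

/-- The block `M(1:s, 1:s)`. -/
def headBlock (M : Matrix (Fin n) (Fin n) ℝ) (s : ℕ) :
    Matrix {i : Fin n // (i : ℕ) < s} {j : Fin n // (j : ℕ) < s} ℝ :=
  M.toBlock (fun i => (i : ℕ) < s) (fun j => (j : ℕ) < s)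

/-- The block `M(s+1:n, s+1:n)`. -/
def tailBlock (M : Matrix (Fin n) (Fin n) ℝ) (s : ℕ) :
    Matrix {i : Fin n // s ≤ (i : ℕ)} {j : Fin n // s ≤ (j : ℕ)} ℝ :=
  M.toBlock (fun i => s ≤ (i : ℕ)) (fun j => s ≤ (j : ℕ))

theorem sum_eq_sum_head_add_sum_tail (f : Fin n → ℝ) (s : ℕ) :
    ∑ i, f i = (∑ i : {i : Fin n // (i : ℕ) < s}, f i) + ∑ i : {i : Fin n // s ≤ (i : ℕ)}, f i := by
  rw [← Fintype.sum_subtype_add_sum_subtype (fun i : Fin n => (i : ℕ) < s) f]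
  congr 1
  exact Fintype.sum_equiv (Equiv.subtypeEquivRight fun i => not_lt) _ _ fun _ => rfl

variable (M N : Matrix (Fin n) (Fin n) ℝ) (s : ℕ)

theorem lowerBlock_mul : lowerBlock (M * N) s
    = lowerBlock M s * headBlock N s + tailBlock M s * lowerBlock N s := by
  ext i j
  exact sum_eq_sum_head_add_sum_tail _ s

theorem headBlock_mul : headBlock (M * N) s
    = headBlock M s * headBlock N s + upperBlock M s * lowerBlock N s := by
  ext i j
  exact sum_eq_sum_head_add_sum_tail _ s

theorem upperBlock_mul : upperBlock (M * N) s
    = headBlock M s * upperBlock N s + upperBlock M s * tailBlock N s := by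
  ext i j
  exact sum_eq_sum_head_add_sum_tail _ s

theorem rank_lowerBlock_mul_le : (lowerBlock (M * N) s).rank
    ≤ (lowerBlock M s).rank + (lowerBlock N s).rank := by
  rw [lowerBlock_mul]
  exact (rank_add_le _ _).trans
    (add_le_add (Matrix.rank_mul_le_left _ _) (Matrix.rank_mul_le_right _ _))

theorem rank_upperBlock_mul_le : (upperBlock (M * N) s).rank
    ≤ (upperBlock M s).rank + (upperBlock N s).rank := by
  rw [upperBlock_mul, add_comm (upperBlock M s).rank]
  exact (rank_add_le _ _).trans
    (add_le_add (Matrix.rank_mul_le_right _ _) (Matrix.rank_mul_le_left _ _))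

theorem rank_lowerBlock_transpose : (lowerBlock Mᵀ s).rank = (upperBlock M s).rank :=
  (upperBlock M s).rank_transpose

theorem rank_lowerBlock_le_qsrank {s : ℕ} (hs : 1 ≤ s) (hsn : s < n) :
    (lowerBlock M s).rank ≤ qsrank M :=
  (le_max_left _ _).trans (Finset.le_sup
    (f := fun s => max (lowerBlock M s).rank (upperBlock M s).rank) (Finset.mem_Ico.2 ⟨hs, hsn⟩))

theorem rank_upperBlock_le_qsrank {s : ℕ} (hs : 1 ≤ s) (hsn : s < n) :
    (upperBlock M s).rank ≤ qsrank M :=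
  (le_max_right _ _).trans (Finset.le_sup
    (f := fun s => max (lowerBlock M s).rank (upperBlock M s).rank) (Finset.mem_Ico.2 ⟨hs, hsn⟩))

end Blocks

/-! ### Ranks and norms of the Cholesky factor and its inverse. -/

section Cholesky

variable {n : ℕ} {L F : Matrix (Fin n) (Fin n) ℝ}

theorem IsCholeskyFactor.isUnit_det (h : IsCholeskyFactor L F) : IsUnit L.det := by
  rw [Matrix.det_of_isLowerTriangular L fun i j hij => h.lower i j hij]
  exact (Finset.prod_pos fun i _ => h.diag_pos i).ne'.isUnit

theorem IsCholeskyFactor.inv_mul (h : IsCholeskyFactor L F) : L⁻¹ * L = 1 :=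
  Matrix.nonsing_inv_mul L h.isUnit_det

theorem IsCholeskyFactor.mul_inv (h : IsCholeskyFactor L F) : L * L⁻¹ = 1 :=
  Matrix.mul_nonsing_inv L h.isUnit_det

theorem IsCholeskyFactor.upperBlock_eq_zero (h : IsCholeskyFactor L F) (s : ℕ) :
    upperBlock L s = 0 := by
  ext i j
  exact h.lower _ _ (Fin.lt_def.2 (i.2.trans_le j.2))

theorem upperBlock_one (s : ℕ) : upperBlock (1 : Matrix (Fin n) (Fin n) ℝ) s = 0 := by
  ext i j
  exact Matrix.one_apply_ne fun h => absurd (i.2.trans_le j.2) (by rw [h]; exact lt_irrefl _)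

theorem lowerBlock_one (s : ℕ) : lowerBlock (1 : Matrix (Fin n) (Fin n) ℝ) s = 0 := by
  ext i j
  exact Matrix.one_apply_ne fun h => absurd (j.2.trans_le i.2) (by rw [h]; exact lt_irrefl _)

theorem headBlock_one (s : ℕ) : headBlock (1 : Matrix (Fin n) (Fin n) ℝ) s = 1 :=
  Matrix.submatrix_one _ Subtype.val_injective

theorem IsCholeskyFactor.headBlock_mul_headBlock_inv (h : IsCholeskyFactor L F) (s : ℕ) :
    headBlock L s * headBlock L⁻¹ s = 1 := by
  have := headBlock_mul L L⁻¹ s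
  rw [h.mul_inv, headBlock_one, h.upperBlock_eq_zero, Matrix.zero_mul, add_zero] at this
  exact this.symm

theorem IsCholeskyFactor.upperBlock_inv_eq_zero (h : IsCholeskyFactor L F) (s : ℕ) :
    upperBlock L⁻¹ s = 0 := by
  have := upperBlock_mul L L⁻¹ s
  rw [h.mul_inv, upperBlock_one, h.upperBlock_eq_zero, Matrix.zero_mul, add_zero] at this
  have h2 : headBlock L⁻¹ s * headBlock L s = 1 :=
    mul_eq_one_comm.1 (h.headBlock_mul_headBlock_inv s)
  rw [← Matrix.one_mul (upperBlock L⁻¹ s), ← h2, Matrix.mul_assoc, ← this, Matrix.mul_zero]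

/-- Since L₁₂ = 0, F₂₁ = L₂₁L₁₁ᵀ with L₁₁ invertible. -/
theorem IsCholeskyFactor.rank_lowerBlock_le (h : IsCholeskyFactor L F) (s : ℕ) :
    (lowerBlock L s).rank ≤ (lowerBlock F s).rank := by
  have h1 : lowerBlock F s = lowerBlock L s * (headBlock L s)ᵀ := by
    have e : lowerBlock Lᵀ s = (upperBlock L s)ᵀ := rfl
    rw [← h.mul_transpose, lowerBlock_mul, e, h.upperBlock_eq_zero, Matrix.transpose_zero,
      Matrix.mul_zero, add_zero]
    rfl
  have h2 : (headBlock L s)ᵀ * (headBlock L⁻¹ s)ᵀ = 1 := by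
    rw [← Matrix.transpose_mul, mul_eq_one_comm.1 (h.headBlock_mul_headBlock_inv s),
      Matrix.transpose_one]
  have h3 : lowerBlock L s = lowerBlock F s * (headBlock L⁻¹ s)ᵀ := by
    rw [h1, Matrix.mul_assoc, h2, Matrix.mul_one]
  rw [h3]
  exact Matrix.rank_mul_le_left _ _

/-- The (2,1) block of L⁻¹L = 1 gives (L⁻¹)₂₁ = -(L⁻¹)₂₂ L₂₁ (L⁻¹)₁₁. -/
theorem IsCholeskyFactor.rank_lowerBlock_inv_le (h : IsCholeskyFactor L F) (s : ℕ) :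
    (lowerBlock L⁻¹ s).rank ≤ (lowerBlock F s).rank := by
  have h1 := lowerBlock_mul L⁻¹ L s
  rw [h.inv_mul, lowerBlock_one] at h1
  have h2 : lowerBlock L⁻¹ s = -(tailBlock L⁻¹ s * lowerBlock L s) * headBlock L⁻¹ s := by
    rw [← eq_neg_of_add_eq_zero_left h1.symm, Matrix.mul_assoc, h.headBlock_mul_headBlock_inv,
      Matrix.mul_one]
  rw [h2]
  refine (Matrix.rank_mul_le_left _ _).trans ?_
  rw [rank_neg]
  exact (Matrix.rank_mul_le_right _ _).trans (h.rank_lowerBlock_le s)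

theorem IsCholeskyFactor.norm_mul_self (h : IsCholeskyFactor L F) : ‖L‖ * ‖L‖ = ‖F‖ := by
  have := Matrix.l2_opNorm_conjTranspose_mul_self Lᴴ
  rw [Matrix.conjTranspose_conjTranspose, Matrix.l2_opNorm_conjTranspose,
    Matrix.conjTranspose_eq_transpose_of_trivial, h.mul_transpose] at this
  exact this.symm

theorem IsCholeskyFactor.norm_inv_mul_self (h : IsCholeskyFactor L F) :
    ‖L⁻¹‖ * ‖L⁻¹‖ = ‖F⁻¹‖ := by
  have := Matrix.l2_opNorm_conjTranspose_mul_self L⁻¹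
  rw [Matrix.conjTranspose_eq_transpose_of_trivial, Matrix.transpose_nonsing_inv,
    ← Matrix.mul_inv_rev, h.mul_transpose] at this
  exact this.symm

end Cholesky

end QSRiccati
end

noncomputable section

namespace QSRiccati

open Polynomial Metric

/-! ### Real and complex quadratic forms. -/

section QuadraticForm

variable {n : ℕ}

theorem dotProduct_mulVec_le (M : Matrix (Fin n) (Fin n) ℝ) (x : EuclideanSpace ℝ (Fin n)) :
    x.ofLp ⬝ᵥ (M *ᵥ x.ofLp) ≤ ‖M‖ * ‖x‖ ^ 2 := by
  have h1 := real_inner_le_norm x (WithLp.toLp 2 (M *ᵥ x.ofLp))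
  have h2 := Matrix.l2_opNorm_mulVec M x
  have h3 : inner ℝ x (WithLp.toLp 2 (M *ᵥ x.ofLp)) = x.ofLp ⬝ᵥ (M *ᵥ x.ofLp) := by
    rw [EuclideanSpace.inner_eq_star_dotProduct, star_trivial, dotProduct_comm]
  rw [h3] at h1
  calc _ ≤ ‖x‖ * (‖M‖ * ‖x‖) := h1.trans (by gcongr; exact h2)
    _ = _ := by ring

/-- The largest eigenvalue of a real symmetric matrix bounds its quadratic form. -/
theorem exists_eigenvector_forall_le [NeZero n] {S : Matrix (Fin n) (Fin n) ℝ}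
    (hS : S.IsHermitian) : ∃ (μ : ℝ) (v : EuclideanSpace ℝ (Fin n)), ‖v‖ = 1 ∧
      S *ᵥ v.ofLp = μ • v.ofLp ∧ ∀ x : EuclideanSpace ℝ (Fin n),
        x.ofLp ⬝ᵥ (S *ᵥ x.ofLp) ≤ μ * ‖x‖ ^ 2 := by
  set T := Matrix.toEuclideanCLM (𝕜 := ℝ) S
  have hT : IsSelfAdjoint T := by
    have : star T = T := by
      rw [← map_star]
      exact congrArg _ hS
    exact this
  have hq : ∀ x, T.reApplyInnerSelf x = x.ofLp ⬝ᵥ (S *ᵥ x.ofLp) := fun x => by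
    rw [ContinuousLinearMap.reApplyInnerSelf_apply, EuclideanSpace.inner_eq_star_dotProduct,
      Matrix.ofLp_toEuclideanCLM]
    rfl
  obtain ⟨v, hv, hmax⟩ := (isCompact_sphere (0 : EuclideanSpace ℝ (Fin n)) 1).exists_isMaxOn
    ⟨EuclideanSpace.single 0 1, by simp⟩ T.reApplyInnerSelf_continuous.continuousOn
  have hv1 : ‖v‖ = 1 := by simpa using hv
  have heig := hT.eq_smul_self_of_isLocalExtrOn_real (x₀ := v) (by
    rw [hv1]
    exact Or.inr hmax.localize)
  have hray : T.rayleighQuotient v = T.reApplyInnerSelf v := by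
    simp [ContinuousLinearMap.rayleighQuotient, hv1]
  refine ⟨T.reApplyInnerSelf v, v, hv1, ?_, fun x => ?_⟩
  · have := congrArg WithLp.ofLp heig
    rw [Matrix.ofLp_toEuclideanCLM, hray] at this
    exact this
  · rcases eq_or_ne x 0 with rfl | hx
    · simp
    have hx' : ‖x‖ ≠ 0 := norm_ne_zero_iff.2 hx
    have h1 : T.reApplyInnerSelf (‖x‖⁻¹ • x) ≤ T.reApplyInnerSelf v :=
      hmax (by simp [norm_smul, hx'])
    rw [T.reApplyInnerSelf_smul, norm_inv, norm_norm, inv_pow, inv_mul_le_iff₀ (by positivity),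
      hq x] at h1
    linarith

theorem star_dotProduct_map_ofReal_mulVec {S : Matrix (Fin n) (Fin n) ℝ} (hS : S.IsHermitian)
    (a b : Fin n → ℝ) : (star fun j => (a j + b j * Complex.I : ℂ)) ⬝ᵥ
      (S.map Complex.ofReal *ᵥ fun j => (a j + b j * Complex.I : ℂ))
      = ((a ⬝ᵥ (S *ᵥ a) + b ⬝ᵥ (S *ᵥ b) : ℝ) : ℂ) := by
  have hsym : a ⬝ᵥ (S *ᵥ b) = b ⬝ᵥ (S *ᵥ a) := by
    have hT : Sᵀ = S := by
      rwa [Matrix.IsHermitian, Matrix.conjTranspose_eq_transpose_of_trivial] at hS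
    rw [Matrix.dotProduct_mulVec, ← Matrix.mulVec_transpose, hT, dotProduct_comm]
  have h1 : (star fun j => (a j + b j * Complex.I : ℂ)) ⬝ᵥ
      (S.map Complex.ofReal *ᵥ fun j => (a j + b j * Complex.I : ℂ))
      = ((a ⬝ᵥ (S *ᵥ a) + b ⬝ᵥ (S *ᵥ b) : ℝ) : ℂ)
        + ((a ⬝ᵥ (S *ᵥ b) - b ⬝ᵥ (S *ᵥ a) : ℝ) : ℂ) * Complex.I := by
    rw [map_ofReal_mulVec]
    simp only [dotProduct]
    push_cast
    rw [← Finset.sum_add_distrib, ← Finset.sum_sub_distrib, Finset.sum_mul,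
      ← Finset.sum_add_distrib]
    refine Finset.sum_congr rfl fun j _ => ?_
    simp only [Pi.star_apply, RCLike.star_def, map_add, map_mul, Complex.conj_ofReal,
      Complex.conj_I]
    linear_combination (-(b j : ℂ) * ((S *ᵥ b) j : ℂ)) * Complex.I_mul_I
  rw [h1, hsym, sub_self]
  simp

theorem star_dotProduct_transpose_mulVec {ι : Type*} [Fintype ι] (M : Matrix ι ι ℂ) (x : ι → ℂ) :
    star x ⬝ᵥ (Mᵀ *ᵥ x) = star (star x) ⬝ᵥ (M *ᵥ star x) := by
  rw [Matrix.dotProduct_mulVec, Matrix.vecMul_transpose, star_star, dotProduct_comm]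

end QuadraticForm

/-! ### Reduction to a single Zolotarev competitor. -/

section Zolotarev

theorem iSup_ratModulus_ne_top {S : Set ℂ} (hS : IsCompact S) (p : ℂ[X]) {q : ℂ[X]}
    (hq : ∀ z ∈ S, q.eval z ≠ 0) : ⨆ z ∈ S, ratModulus p q z ≠ ⊤ := by
  obtain ⟨K, hK⟩ := hS.exists_bound_of_continuousOn
    (p.continuous.continuousOn.div q.continuous.continuousOn hq)
  refine ((iSup₂_le fun z hz => ?_).trans_lt (ENNReal.ofReal_lt_top (r := K))).ne
  have h1 : ratModulus p q z = ‖p.eval z / q.eval z‖ₑ := by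
    rw [ratModulus, div_eq_mul_inv (p.eval z), enorm_mul, enorm_inv (hq z hz)]
    rfl
  rw [h1, ← ofReal_norm]
  exact ENNReal.ofReal_le_ofReal (hK z hz)

theorem norm_eval_le_iSup_ratModulus_mul {S : Set ℂ} (hS : IsCompact S) (p : ℂ[X]) {q : ℂ[X]}
    (hq : ∀ z ∈ S, q.eval z ≠ 0) {z : ℂ} (hz : z ∈ S) :
    ‖p.eval z‖ ≤ (⨆ z ∈ S, ratModulus p q z).toReal * ‖q.eval z‖ := by
  have h1 : ratModulus p q z ≤ ⨆ z ∈ S, ratModulus p q z :=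
    le_iSup₂ (f := fun z (_ : z ∈ S) => ratModulus p q z) z hz
  have h2 := ENNReal.toReal_mono (iSup_ratModulus_ne_top hS p hq) h1
  rw [ratModulus, ENNReal.toReal_div, toReal_enorm, toReal_enorm] at h2
  rwa [div_le_iff₀ (norm_pos_iff.2 (hq z hz))] at h2

/-- The inverse of an infimum is the supremum of the inverses; since p has no zero on T, the inverse
of |p/q| is |q/p| even at poles. -/
theorem zolotarevRatio_eq_mul (p q : ℂ[X]) (S T : Set ℂ) (hp : ∀ z ∈ T, p.eval z ≠ 0) :
    zolotarevRatio p q S T = (⨆ z ∈ S, ratModulus p q z) * ⨆ z ∈ T, ratModulus q p z := by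
  rw [zolotarevRatio, div_eq_mul_inv]
  congr 1
  simp only [ENNReal.inv_iInf]
  refine iSup_congr fun z => iSup_congr fun hz => ?_
  exact ENNReal.inv_div (Or.inr enorm_ne_top) (Or.inr (by simpa using hp z hz))

/-- To bound by the Zolotarev number it is enough to bound by the ratio of each competitor. -/
theorem le_mul_zolotarev {h : ℕ} {S T : Set ℂ} (hS : IsCompact S) (hT : IsCompact T) {x c : ℝ}
    (hc : 0 ≤ c)
    (hx : ∀ p q : ℂ[X], p.natDegree ≤ h → q.natDegree ≤ h → (∀ z ∈ S, q.eval z ≠ 0) →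
      (∀ z ∈ T, p.eval z ≠ 0) →
      x ≤ c * ((⨆ z ∈ S, ratModulus p q z).toReal * (⨆ z ∈ T, ratModulus q p z).toReal)) :
    x ≤ c * zolotarev h S T := by
  rcases hc.eq_or_lt with rfl | hc
  · simpa using hx 1 1 (by simp) (by simp) (by simp) (by simp)
  rw [← div_le_iff₀' hc]
  have hfin : zolotarevENN h S T ≠ ⊤ := ((zolotarevENN_le_one h S T).trans_lt ENNReal.one_lt_top).ne
  refine (ENNReal.ofReal_le_iff_le_toReal hfin).1 ?_
  refine le_iInf fun p => le_iInf fun q => le_iInf fun hpq => ?_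
  obtain ⟨hp, hq, hqS, hpT⟩ := hpq
  rw [zolotarevRatio_eq_mul p q S T hpT, ENNReal.ofReal_le_iff_le_toReal (ENNReal.mul_ne_top
    (iSup_ratModulus_ne_top hS p hqS) (iSup_ratModulus_ne_top hT q hpT)), ENNReal.toReal_mul,
    div_le_iff₀' hc]
  exact hx p q hp hq hqS hpT

end Zolotarev

/-! ### The Riccati equation and its off-diagonal blocks. -/

section Riccati

variable {n : ℕ} {A F Q X L : Matrix (Fin n) (Fin n) ℝ}

/-- The Riccati equation after the congruence that turns the quadratic coefficient into the
identity. -/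
theorem IsCholeskyFactor.riccati (hL : IsCholeskyFactor L F)
    (h : Aᵀ * X + X * A - X * F * X + Q = 0) :
    (L⁻¹ * A * L)ᵀ * (Lᵀ * X * L) + Lᵀ * X * L * (L⁻¹ * A * L)
      - Lᵀ * X * L * (Lᵀ * X * L) + Lᵀ * Q * L = 0 := by
  have h1 : L⁻¹ᵀ * Lᵀ = 1 := by rw [← Matrix.transpose_mul, hL.mul_inv, Matrix.transpose_one]
  have e1 : (L⁻¹ * A * L)ᵀ * (Lᵀ * X * L) = Lᵀ * (Aᵀ * X) * L := by
    calc (L⁻¹ * A * L)ᵀ * (Lᵀ * X * L) = Lᵀ * Aᵀ * (L⁻¹ᵀ * Lᵀ) * X * L := by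
          simp only [Matrix.transpose_mul, Matrix.mul_assoc]
      _ = _ := by rw [h1, Matrix.mul_one, Matrix.mul_assoc Lᵀ Aᵀ X]
  have e2 : Lᵀ * X * L * (L⁻¹ * A * L) = Lᵀ * (X * A) * L := by
    calc Lᵀ * X * L * (L⁻¹ * A * L) = Lᵀ * X * (L * L⁻¹) * A * L := by
          simp only [Matrix.mul_assoc]
      _ = _ := by rw [hL.mul_inv, Matrix.mul_one, Matrix.mul_assoc Lᵀ X A]
  have e3 : Lᵀ * X * L * (Lᵀ * X * L) = Lᵀ * (X * F * X) * L := by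
    rw [← hL.mul_transpose]
    simp only [Matrix.mul_assoc]
  rw [e1, e2, e3, ← Matrix.add_mul, ← Matrix.mul_add, ← Matrix.sub_mul, ← Matrix.mul_sub,
    ← Matrix.add_mul, ← Matrix.mul_add, h, Matrix.mul_zero, Matrix.zero_mul]

/-- The shifted quadratic form of the transformed closed-loop matrix takes its values in
`setE`. -/
theorem star_dotProduct_closedLoop_mem_setE [NeZero n] (hX : X.PosSemidef)
    (hCARE : Aᵀ * X + X * A - X * F * X + Q = 0) (hL : IsCholeskyFactor L F)
    (hW : realNumericalRange (L⁻¹ * A * L) ⊆ {z : ℂ | z.re < 0})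
    {x : EuclideanSpace ℂ (Fin n)} (hx : ‖x‖ = 1) :
    star x.ofLp ⬝ᵥ ((L⁻¹ * A * L - Lᵀ * X * L).map Complex.ofReal *ᵥ x.ofLp)
      ∈ setE A F Q L := by
  set A' := L⁻¹ * A * L with hA'
  set X' := Lᵀ * X * L with hX'
  have hXp : X'.PosSemidef := by
    have := hX.conjTranspose_mul_mul_same L
    rwa [Matrix.conjTranspose_eq_transpose_of_trivial] at this
  have hric := hL.riccati hCARE
  rw [← hA', ← hX'] at hric
  obtain ⟨μ, v, hv, heig, hμ⟩ := exists_eigenvector_forall_le hXp.1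
  have hnn : ∀ a : Fin n → ℝ, 0 ≤ a ⬝ᵥ (X' *ᵥ a) := fun a => by
    simpa using hXp.dotProduct_mulVec_nonneg a
  have hvv : v.ofLp ⬝ᵥ v.ofLp = 1 := by
    have h1 := EuclideanSpace.inner_eq_star_dotProduct v v
    rw [real_inner_self_eq_norm_sq, hv, star_trivial] at h1
    rw [← h1]
    norm_num
  have hμ0 : 0 ≤ μ := by
    have := hnn v.ofLp
    rwa [heig, dotProduct_smul, hvv, smul_eq_mul, mul_one] at this
  have hAneg : v.ofLp ⬝ᵥ (A' *ᵥ v.ofLp) < 0 := by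
    set y : EuclideanSpace ℂ (Fin n) :=
      WithLp.toLp 2 fun j => (v j + (0 : EuclideanSpace ℝ (Fin n)) j * Complex.I : ℂ) with hy
    have hy1 : ‖y‖ = 1 := by
      have h1 := norm_sq_complex_eq v 0
      rw [← hy, hv, norm_zero] at h1
      nlinarith [norm_nonneg y]
    have h2 : (star y.ofLp ⬝ᵥ (A'.map Complex.ofReal *ᵥ y.ofLp)).re < 0 := hW ⟨y, hy1, rfl⟩
    have h3 : star y.ofLp ⬝ᵥ (A'.map Complex.ofReal *ᵥ y.ofLp)
        = ((v.ofLp ⬝ᵥ (A' *ᵥ v.ofLp) : ℝ) : ℂ) := by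
      rw [hy, map_ofReal_mulVec]
      simp only [dotProduct]
      push_cast
      exact Finset.sum_congr rfl fun j _ => by simp
    rw [h3] at h2
    exact_mod_cast h2
  have hQle : v.ofLp ⬝ᵥ ((Lᵀ * Q * L) *ᵥ v.ofLp) ≤ ‖F‖ * ‖Q‖ := by
    have e : v.ofLp ⬝ᵥ ((Lᵀ * Q * L) *ᵥ v.ofLp) = (L *ᵥ v.ofLp) ⬝ᵥ (Q *ᵥ (L *ᵥ v.ofLp)) := by
      rw [← Matrix.mulVec_mulVec, ← Matrix.mulVec_mulVec, Matrix.dotProduct_mulVec,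
        Matrix.vecMul_transpose]
    have h1 := dotProduct_mulVec_le Q (WithLp.toLp 2 (L *ᵥ v.ofLp))
    have h2 : ‖WithLp.toLp 2 (L *ᵥ v.ofLp)‖ ≤ ‖L‖ := by
      have := Matrix.l2_opNorm_mulVec L v
      rw [hv, mul_one] at this
      exact this
    rw [e]
    refine h1.trans ?_
    rw [mul_comm, ← hL.norm_mul_self, ← pow_two]
    gcongr
  -- At the top eigenvector v the equation reads 2μ vᵀA'v - μ² + vᵀQ'v = 0, and the first term is
  -- nonpositive.
  have hμ2 : μ ^ 2 ≤ ‖F‖ * ‖Q‖ := by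
    have h1 := congrArg (fun M : Matrix (Fin n) (Fin n) ℝ => v.ofLp ⬝ᵥ (M *ᵥ v.ofLp)) hric
    have hvX : v.ofLp ᵥ* X' = μ • v.ofLp := by
      rw [← heig, ← Matrix.mulVec_transpose]
      congr 1
      have := hXp.1
      rwa [Matrix.IsHermitian, Matrix.conjTranspose_eq_transpose_of_trivial] at this
    have t1 : v.ofLp ⬝ᵥ ((A'ᵀ * X') *ᵥ v.ofLp) = μ * (v.ofLp ⬝ᵥ (A' *ᵥ v.ofLp)) := by
      rw [← Matrix.mulVec_mulVec, heig, Matrix.mulVec_smul, dotProduct_smul,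
        Matrix.dotProduct_mulVec, Matrix.vecMul_transpose, dotProduct_comm, smul_eq_mul]
    have t2 : ∀ M : Matrix (Fin n) (Fin n) ℝ,
        v.ofLp ⬝ᵥ ((X' * M) *ᵥ v.ofLp) = μ * (v.ofLp ⬝ᵥ (M *ᵥ v.ofLp)) := fun M => by
      rw [← Matrix.mulVec_mulVec, Matrix.dotProduct_mulVec, hvX, smul_dotProduct, smul_eq_mul]
    simp only [Matrix.add_mulVec, Matrix.sub_mulVec, dotProduct_add, dotProduct_sub, t1, t2, heig,
      dotProduct_smul, hvv, Matrix.zero_mulVec, dotProduct_zero, smul_eq_mul] at h1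
    nlinarith [mul_nonneg hμ0 (neg_nonneg.2 hAneg.le)]
  obtain ⟨a, b, hab⟩ := exists_eq_re_add_im x
  have hXx : star x.ofLp ⬝ᵥ (X'.map Complex.ofReal *ᵥ x.ofLp)
      = ((a.ofLp ⬝ᵥ (X' *ᵥ a.ofLp) + b.ofLp ⬝ᵥ (X' *ᵥ b.ofLp) : ℝ) : ℂ) := by
    rw [hab]
    exact star_dotProduct_map_ofReal_mulVec hXp.1 a.ofLp b.ofLp
  have hn : ‖a‖ ^ 2 + ‖b‖ ^ 2 = 1 := by
    rw [← norm_sq_complex_eq a b, ← hab, WithLp.toLp_ofLp, hx, one_pow]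
  set c := a.ofLp ⬝ᵥ (X' *ᵥ a.ofLp) + b.ofLp ⬝ᵥ (X' *ᵥ b.ofLp)
  have hc0 : 0 ≤ c := add_nonneg (hnn _) (hnn _)
  have hcμ : c ≤ μ := by
    have h1 := hμ a
    have h2 := hμ b
    calc c ≤ μ * ‖a‖ ^ 2 + μ * ‖b‖ ^ 2 := add_le_add h1 h2
      _ = μ := by rw [← mul_add, hn, mul_one]
  refine Set.mem_add.2 ⟨_, ⟨x, hx, rfl⟩, ((-c : ℝ) : ℂ), ⟨-c, ⟨?_, by linarith⟩, rfl⟩, ?_⟩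
  · have h1 : 0 ≤ tau A' := abs_nonneg _
    have h2 : μ ≤ Real.sqrt (tau A' ^ 2 + ‖F‖ * ‖Q‖) :=
      Real.le_sqrt_of_sq_le (by nlinarith [sq_nonneg (tau A')])
    linarith
  · have e : (A' - X').map Complex.ofReal = A'.map Complex.ofReal - X'.map Complex.ofReal :=
      Matrix.map_sub _ Complex.ofReal_sub _ _
    rw [e, Matrix.sub_mulVec, dotProduct_sub, hXx]
    push_cast
    ring

/-- An approximation of the off-diagonal block of the transformed solution bounds the singular
values of the off-diagonal blocks of the solution. -/
theorem IsCholeskyFactor.sigma_block_le (hL : IsCholeskyFactor L F) (hX : X.PosSemidef) {s r : ℕ}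
    {Z : Matrix {i : Fin n // s ≤ (i : ℕ)} {j : Fin n // (j : ℕ) < s} ℂ} (hZ : Z.rank ≤ r)
    {ε : ℝ} (hε : 0 ≤ ε)
    (hZε : ‖(lowerBlock (Lᵀ * X * L) s).map Complex.ofReal - Z‖
      ≤ ε * ‖(lowerBlock (Lᵀ * X * L) s).map Complex.ofReal‖) :
    sigma (r + (lowerBlock F s).rank + 1) (lowerBlock X s) ≤ cond F * ε * ‖X‖ ∧
      sigma (r + (lowerBlock F s).rank + 1) (upperBlock X s) ≤ cond F * ε * ‖X‖ := by
  set X' := Lᵀ * X * L with hX'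
  set K := L⁻¹
  have hXK : X = Kᵀ * (X' * K) := by
    have h1 : Kᵀ * Lᵀ = 1 := by rw [← Matrix.transpose_mul, hL.mul_inv, Matrix.transpose_one]
    calc X = (Kᵀ * Lᵀ) * X * (L * K) := by rw [h1, hL.mul_inv, Matrix.one_mul, Matrix.mul_one]
      _ = _ := by simp only [hX', Matrix.mul_assoc]
  have hlow : lowerBlock X s
      = (tailBlock K s)ᵀ * (lowerBlock X' s * headBlock K s + tailBlock X' s * lowerBlock K s) := by
    have e1 : lowerBlock Kᵀ s = 0 := by
      change (upperBlock K s)ᵀ = 0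
      rw [hL.upperBlock_inv_eq_zero, Matrix.transpose_zero]
    conv_lhs => rw [hXK]
    rw [lowerBlock_mul, e1, Matrix.zero_mul, zero_add, lowerBlock_mul]
    rfl
  set c : ∀ {α β : Type}, Matrix α β ℝ → Matrix α β ℂ := fun M => M.map Complex.ofReal
  have cmul : ∀ {α β γ : Type} [Fintype β] (M : Matrix α β ℝ) (N : Matrix β γ ℝ),
      c (M * N) = c M * c N := fun M N => Matrix.map_mul (f := Complex.ofRealHom)
  have cadd : ∀ {α β : Type} (M N : Matrix α β ℝ), c (M + N) = c M + c N := fun M N =>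
    Matrix.map_add _ Complex.ofReal_add _ _
  -- The formula for X₂₁ with X'₂₁ replaced by Z. The other summand is kept exactly, at the price of
  -- the rank of K₂₁.
  set W := c (tailBlock K s)ᵀ * (Z * c (headBlock K s) + c (tailBlock X' s) * c (lowerBlock K s))
  have hWr : W.rank ≤ r + (lowerBlock F s).rank := by
    refine (Matrix.rank_mul_le_right _ _).trans ((rank_add_le _ _).trans (add_le_add ?_ ?_))
    · exact (Matrix.rank_mul_le_left _ _).trans hZ
    · exact (Matrix.rank_mul_le_right _ _).trans
        ((rank_map_ofReal_le _).trans (hL.rank_lowerBlock_inv_le s))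
  have hblock : ∀ {α β : Type} [Fintype α] [Fintype β] [DecidableEq α] [DecidableEq β]
      (M : Matrix (Fin n) (Fin n) ℝ) (f : α → Fin n) (g : β → Fin n), Function.Injective f →
      Function.Injective g → ‖c (M.submatrix f g)‖ ≤ ‖M‖ := fun M f g hf hg =>
    (norm_map_ofReal_le _).trans (norm_submatrix_le M hf hg)
  have hW : ‖c (lowerBlock X s) - W‖ ≤ cond F * ε * ‖X‖ := by
    have e : c (lowerBlock X s) - W
        = c (tailBlock K s)ᵀ * ((c (lowerBlock X' s) - Z) * c (headBlock K s)) := by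
      rw [hlow, cmul, cadd, cmul, cmul, ← Matrix.mul_sub, add_sub_add_right_eq_sub, Matrix.sub_mul]
    have n1 : ‖c (tailBlock K s)ᵀ‖ ≤ ‖K‖ := by
      rw [← Matrix.l2_opNorm_conjTranspose K, Matrix.conjTranspose_eq_transpose_of_trivial]
      exact hblock Kᵀ _ _ Subtype.val_injective Subtype.val_injective
    have n2 : ‖c (headBlock K s)‖ ≤ ‖K‖ :=
      hblock K _ _ Subtype.val_injective Subtype.val_injective
    have n3 : ‖c (lowerBlock X' s)‖ ≤ ‖F‖ * ‖X‖ := by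
      refine (hblock X' _ _ Subtype.val_injective Subtype.val_injective).trans ?_
      calc ‖Lᵀ * X * L‖ ≤ ‖Lᵀ‖ * ‖X‖ * ‖L‖ :=
            (norm_mul_le _ _).trans (by gcongr; exact norm_mul_le _ _)
        _ = ‖F‖ * ‖X‖ := by
          rw [← Matrix.conjTranspose_eq_transpose_of_trivial, Matrix.l2_opNorm_conjTranspose,
            ← hL.norm_mul_self]
          ring
    rw [e]
    calc _ ≤ ‖c (tailBlock K s)ᵀ‖ * (‖c (lowerBlock X' s) - Z‖ * ‖c (headBlock K s)‖) :=
          (Matrix.l2_opNorm_mul _ _).trans (by gcongr; exact Matrix.l2_opNorm_mul _ _)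
      _ ≤ ‖K‖ * (ε * (‖F‖ * ‖X‖) * ‖K‖) := by
          gcongr
          exact hZε.trans (by gcongr)
      _ = ‖F‖ * (‖K‖ * ‖K‖) * ε * ‖X‖ := by ring
      _ = _ := by rw [hL.norm_inv_mul_self]; rfl
  refine ⟨(sigma_le_norm_sub _ W hWr).trans hW, ?_⟩
  have hXt : Xᵀ = X := by
    have := hX.1
    rwa [Matrix.IsHermitian, Matrix.conjTranspose_eq_transpose_of_trivial] at this
  have hup : upperBlock X s = (lowerBlock X s)ᵀ := by
    conv_lhs => rw [← hXt]
    rfl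
  rw [hup]
  refine (sigma_le_norm_sub _ Wᴴ (by
    open scoped ComplexOrder in rwa [Matrix.rank_conjTranspose])).trans ?_
  have e : ((lowerBlock X s)ᵀ).map Complex.ofReal = (c (lowerBlock X s))ᴴ := by
    ext i j
    simp [c, Matrix.conjTranspose_apply]
  rw [e, ← Matrix.conjTranspose_sub, Matrix.l2_opNorm_conjTranspose]
  exact hW

/-- The off-diagonal block of the transformed solution solves a Sylvester equation with a low-rank
right-hand side. -/
theorem IsCholeskyFactor.rank_sylvester_le (hL : IsCholeskyFactor L F)
    (hCARE : Aᵀ * X + X * A - X * F * X + Q = 0) {s : ℕ} (hs : 1 ≤ s) (hsn : s < n) :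
    (tailBlock ((L⁻¹ * A * L)ᵀ - Lᵀ * X * L) s * lowerBlock (Lᵀ * X * L) s
      + lowerBlock (Lᵀ * X * L) s * headBlock (L⁻¹ * A * L - Lᵀ * X * L) s).rank
      ≤ 2 * qsrank A + 3 * qsrank F + qsrank Q := by
  have hric := hL.riccati hCARE
  set A' := L⁻¹ * A * L with hA'
  set X' := Lᵀ * X * L
  set Q' := Lᵀ * Q * L with hQ'
  have hblock := congrArg (fun M => lowerBlock M s) hric
  have hadd : ∀ M N : Matrix (Fin n) (Fin n) ℝ,
      lowerBlock (M + N) s = lowerBlock M s + lowerBlock N s := fun _ _ => rfl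
  have hsub : ∀ M N : Matrix (Fin n) (Fin n) ℝ,
      lowerBlock (M - N) s = lowerBlock M s - lowerBlock N s := fun _ _ => rfl
  have hzero : lowerBlock (0 : Matrix (Fin n) (Fin n) ℝ) s = 0 := rfl
  simp only [hadd, hsub, hzero, lowerBlock_mul] at hblock
  have e : tailBlock (A'ᵀ - X') s * lowerBlock X' s + lowerBlock X' s * headBlock (A' - X') s
      = -(lowerBlock A'ᵀ s * headBlock X' s + tailBlock X' s * lowerBlock A' s
        + lowerBlock Q' s) := by
    have h1 : tailBlock (A'ᵀ - X') s = tailBlock A'ᵀ s - tailBlock X' s := rfl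
    have h2 : headBlock (A' - X') s = headBlock A' s - headBlock X' s := rfl
    rw [h1, h2, Matrix.sub_mul, Matrix.mul_sub, ← sub_eq_zero, ← hblock]
    abel
  have hLu := hL.upperBlock_eq_zero s
  have hFr := rank_lowerBlock_le_qsrank F hs hsn
  have hLr := (hL.rank_lowerBlock_le s).trans hFr
  have hKr := (hL.rank_lowerBlock_inv_le s).trans hFr
  -- This block is the transpose of A'₁₂, and the upper blocks of L and L⁻¹ vanish, so `F`
  -- contributes nothing here.
  have r1 : (lowerBlock A'ᵀ s).rank ≤ qsrank A := by
    rw [rank_lowerBlock_transpose, hA']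
    refine (rank_upperBlock_mul_le _ _ s).trans ?_
    have := rank_upperBlock_mul_le L⁻¹ A s
    rw [hL.upperBlock_inv_eq_zero, Matrix.rank_zero] at this
    rw [hLu, Matrix.rank_zero]
    have h3 := rank_upperBlock_le_qsrank A hs hsn
    omega
  have r2 : (lowerBlock A' s).rank ≤ qsrank A + 2 * qsrank F := by
    have h1 : (lowerBlock A' s).rank ≤ _ := rank_lowerBlock_mul_le (L⁻¹ * A) L s
    have h2 := rank_lowerBlock_mul_le L⁻¹ A s
    have h3 := rank_lowerBlock_le_qsrank A hs hsn
    omega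
  have r3 : (lowerBlock Q' s).rank ≤ qsrank Q + qsrank F := by
    have h1 : (lowerBlock Q' s).rank ≤ _ := rank_lowerBlock_mul_le (Lᵀ * Q) L s
    have h2 := rank_lowerBlock_mul_le Lᵀ Q s
    rw [rank_lowerBlock_transpose, hLu, Matrix.rank_zero] at h2
    have h3 := rank_lowerBlock_le_qsrank Q hs hsn
    omega
  rw [e, rank_neg]
  have h1 := rank_add_le (lowerBlock A'ᵀ s * headBlock X' s + tailBlock X' s * lowerBlock A' s)
    (lowerBlock Q' s)
  have h2 := rank_add_le (lowerBlock A'ᵀ s * headBlock X' s) (tailBlock X' s * lowerBlock A' s)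
  have h3 := Matrix.rank_mul_le_left (lowerBlock A'ᵀ s) (headBlock X' s)
  have h4 := Matrix.rank_mul_le_right (tailBlock X' s) (lowerBlock A' s)
  omega

/-- Low-rank approximation of the off-diagonal block of the transformed solution. -/
theorem exists_rank_le_norm_lowerBlock_sub_le (hX : X.PosSemidef)
    (hCARE : Aᵀ * X + X * A - X * F * X + Q = 0) (hL : IsCholeskyFactor L F)
    (hW : realNumericalRange (L⁻¹ * A * L) ⊆ {z : ℂ | z.re < 0}) {s : ℕ} (hs : 1 ≤ s)
    (hsn : s < n) {p q : ℂ[X]} {d : ℕ} (hp : p.natDegree ≤ d) (hq : q.natDegree ≤ d)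
    (hqE : ∀ z ∈ setE A F Q L, q.eval z ≠ 0) (hpE : ∀ z ∈ -setE A F Q L, p.eval z ≠ 0)
    {M M' : ℝ} (hM : 0 ≤ M) (hM' : 0 ≤ M')
    (hMp : ∀ z ∈ setE A F Q L, ‖p.eval z‖ ≤ M * ‖q.eval z‖)
    (hMq : ∀ z ∈ -setE A F Q L, ‖q.eval z‖ ≤ M' * ‖p.eval z‖) :
    ∃ Z : Matrix {i : Fin n // s ≤ (i : ℕ)} {j : Fin n // (j : ℕ) < s} ℂ,
      Z.rank ≤ d * (2 * qsrank A + 3 * qsrank F + qsrank Q) ∧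
      ‖(lowerBlock (Lᵀ * X * L) s).map Complex.ofReal - Z‖
        ≤ 25 * (M * M') * ‖(lowerBlock (Lᵀ * X * L) s).map Complex.ofReal‖ := by
  have : NeZero n := ⟨by omega⟩
  have hrank := hL.rank_sylvester_le hCARE hs hsn
  have hmem := fun (x : EuclideanSpace ℂ (Fin n)) (hx : ‖x‖ = 1) =>
    star_dotProduct_closedLoop_mem_setE hX hCARE hL hW hx
  set A' := L⁻¹ * A * L
  set X' := Lᵀ * X * L with hX'
  have hXt : X'ᵀ = X' := by
    have h1 : Xᵀ = X := by
      have := hX.1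
      rwa [Matrix.IsHermitian, Matrix.conjTranspose_eq_transpose_of_trivial] at this
    rw [hX']
    simp only [Matrix.transpose_mul, Matrix.transpose_transpose, h1, Matrix.mul_assoc]
  have hE := isCompact_setE A F Q L
  have hcE := convex_setE A F Q L
  have hneE := nonempty_setE A F Q L
  set B : Matrix _ _ ℂ := (tailBlock (A'ᵀ - X') s).map Complex.ofReal
  set C : Matrix _ _ ℂ := -(headBlock (A' - X') s).map Complex.ofReal
  set Y : Matrix _ _ ℂ := (lowerBlock X' s).map Complex.ofReal
  have hR : B * Y - Y * C = (tailBlock (A'ᵀ - X') s * lowerBlock X' s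
      + lowerBlock X' s * headBlock (A' - X') s).map Complex.ofReal := by
    rw [Matrix.map_add _ Complex.ofReal_add, Matrix.mul_neg, sub_neg_eq_add]
    congr 1
    · exact (Matrix.map_mul (f := Complex.ofRealHom)).symm
    · exact (Matrix.map_mul (f := Complex.ofRealHom)).symm
  have hB : ∀ u : EuclideanSpace ℂ {i : Fin n // s ≤ (i : ℕ)}, ‖u‖ = 1 →
      star u.ofLp ⬝ᵥ (B *ᵥ u.ofLp) ∈ setE A F Q L := fun u hu => by
    obtain ⟨x, hx, e⟩ := exists_star_dotProduct_submatrix_eq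
      (g := fun i : {i : Fin n // s ≤ (i : ℕ)} => (i : Fin n)) Subtype.val_injective
      ((A'ᵀ - X').map Complex.ofReal) u
    have e1 : (A'ᵀ - X').map Complex.ofReal = ((A' - X').map Complex.ofReal)ᵀ := by
      conv_lhs => rw [← hXt, ← Matrix.transpose_sub]
      rfl
    -- The form of the transpose at x is the form of A' - X' at conj x, again a unit vector.
    have e2 := e.trans (by rw [e1, star_dotProduct_transpose_mulVec])
    have h1 := hmem (WithLp.toLp 2 (star x.ofLp)) (by
      rw [← hu, ← hx, EuclideanSpace.norm_eq, EuclideanSpace.norm_eq]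
      simp)
    exact e2 ▸ h1
  have hC : ∀ u : EuclideanSpace ℂ {j : Fin n // (j : ℕ) < s}, ‖u‖ = 1 →
      star u.ofLp ⬝ᵥ (C *ᵥ u.ofLp) ∈ -setE A F Q L := fun u hu => by
    obtain ⟨x, hx, e⟩ := exists_star_dotProduct_submatrix_eq
      (g := fun i : {i : Fin n // (i : ℕ) < s} => (i : Fin n)) Subtype.val_injective
      ((A' - X').map Complex.ofReal) u
    have h1 := hmem x (hx.trans hu)
    rw [← e] at h1
    rw [Set.mem_neg, Matrix.neg_mulVec, dotProduct_neg, neg_neg]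
    exact h1
  obtain ⟨Z, hZ, hZn⟩ := exists_rank_le_norm_sub_le hR hE hcE hneE hE.neg hcE.neg hneE.neg hB hC hp
    hq hqE hpE hM hM' hMp hMq
  exact ⟨Z, hZ.trans (Nat.mul_le_mul_left d ((rank_map_ofReal_le _).trans hrank)), hZn⟩

theorem sigma_antitone {ι κ : Type*} [Fintype ι] [Fintype κ] [DecidableEq κ] (M : Matrix ι κ ℝ)
    {i j : ℕ} (hij : i ≤ j) : sigma j M ≤ sigma i M :=
  LinearMap.singularValues_antitone _ (Nat.sub_le_sub_right hij 1)

/-- Singular value decay, for one competitor in the Zolotarev problem. -/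
theorem sigma_block_le_mul_mul (hX : X.PosSemidef)
    (hCARE : Aᵀ * X + X * A - X * F * X + Q = 0) (hL : IsCholeskyFactor L F)
    (hW : realNumericalRange (L⁻¹ * A * L) ⊆ {z : ℂ | z.re < 0}) {s : ℕ} (hs : 1 ≤ s)
    (hsn : s < n) {p q : ℂ[X]} {h : ℕ} (hp : p.natDegree ≤ h) (hq : q.natDegree ≤ h)
    (hqE : ∀ z ∈ setE A F Q L, q.eval z ≠ 0) (hpE : ∀ z ∈ -setE A F Q L, p.eval z ≠ 0)
    {M M' : ℝ} (hM : 0 ≤ M) (hM' : 0 ≤ M')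
    (hMp : ∀ z ∈ setE A F Q L, ‖p.eval z‖ ≤ M * ‖q.eval z‖)
    (hMq : ∀ z ∈ -setE A F Q L, ‖q.eval z‖ ≤ M' * ‖p.eval z‖) :
    sigma (h * (4 * qsrank A + 6 * qsrank F + 2 * qsrank Q) + qsrank F + 1) (lowerBlock X s)
        ≤ cond F * ((1 + Real.sqrt 2) ^ 2 * (M * M')) * ‖X‖ ∧
      sigma (h * (4 * qsrank A + 6 * qsrank F + 2 * qsrank Q) + qsrank F + 1) (upperBlock X s)
        ≤ cond F * ((1 + Real.sqrt 2) ^ 2 * (M * M')) * ‖X‖ := by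
  have hw : 5 ≤ (1 + Real.sqrt 2) ^ 2 := by
    have h1 : (1 : ℝ) ≤ Real.sqrt 2 := Real.one_le_sqrt.2 (by norm_num)
    have h2 := Real.sq_sqrt (show (0 : ℝ) ≤ 2 by norm_num)
    nlinarith
  set w := (1 + Real.sqrt 2) ^ 2
  have hF := rank_lowerBlock_le_qsrank F hs hsn
  have hMM : 0 ≤ M * M' := mul_nonneg hM hM'
  have hcond : 0 ≤ cond F := mul_nonneg (norm_nonneg _) (norm_nonneg _)
  obtain ⟨Z, ε, hZ, hε, hZn, hεw⟩ : ∃ (Z : Matrix {i : Fin n // s ≤ (i : ℕ)}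
      {j : Fin n // (j : ℕ) < s} ℂ) (ε : ℝ),
      Z.rank ≤ h * (4 * qsrank A + 6 * qsrank F + 2 * qsrank Q) ∧ 0 ≤ ε ∧
      ‖(lowerBlock (Lᵀ * X * L) s).map Complex.ofReal - Z‖
        ≤ ε * ‖(lowerBlock (Lᵀ * X * L) s).map Complex.ofReal‖ ∧ ε ≤ w * (M * M') := by
    -- If the claimed factor is at least 1, zero is a good enough approximation. Otherwise 5MM' ≤ 1
    -- and squaring the competitor absorbs the constant 25; its degree 2h is paid for by the factor
    -- 2 in t.
    rcases le_total 1 (w * (M * M')) with h1 | h1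
    · exact ⟨0, 1, by simp, zero_le_one, by simp, h1⟩
    · obtain ⟨Z, hZ, hZn⟩ := exists_rank_le_norm_lowerBlock_sub_le hX hCARE hL hW hs hsn
        (p := p ^ 2) (q := q ^ 2) (d := 2 * h) (natDegree_pow_le_of_le 2 hp)
        (natDegree_pow_le_of_le 2 hq) (fun z hz => by simpa using hqE z hz)
        (fun z hz => by simpa using hpE z hz) (sq_nonneg M) (sq_nonneg M')
        (fun z hz => by
          rw [eval_pow, eval_pow, norm_pow, norm_pow, ← mul_pow]
          exact pow_le_pow_left₀ (norm_nonneg _) (hMp z hz) 2)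
        (fun z hz => by
          rw [eval_pow, eval_pow, norm_pow, norm_pow, ← mul_pow]
          exact pow_le_pow_left₀ (norm_nonneg _) (hMq z hz) 2)
      refine ⟨Z, 25 * (M ^ 2 * M' ^ 2), hZ.trans (le_of_eq (by ring)), by positivity, hZn, ?_⟩
      have h2 : 5 * (M * M') ≤ 1 := (mul_le_mul_of_nonneg_right hw hMM).trans h1
      nlinarith [mul_le_mul_of_nonneg_right h2 hMM, mul_le_mul_of_nonneg_right hw hMM]
  obtain ⟨h1, h2⟩ := hL.sigma_block_le hX hZ hε hZn
  have h3 : cond F * ε * ‖X‖ ≤ cond F * (w * (M * M')) * ‖X‖ := by gcongr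
  have h4 : h * (4 * qsrank A + 6 * qsrank F + 2 * qsrank Q) + (lowerBlock F s).rank + 1
      ≤ h * (4 * qsrank A + 6 * qsrank F + 2 * qsrank Q) + qsrank F + 1 := by omega
  exact ⟨(sigma_antitone _ h4).trans (h1.trans h3), (sigma_antitone _ h4).trans (h2.trans h3)⟩

end Riccati

end QSRiccati
end

theorem corollary2p5 (n : ℕ) (A F Q X L : Matrix (Fin n) (Fin n) ℝ) (ra rf rq : ℕ)
    (hra : QSRiccati.qsrank A = ra) (hrf : QSRiccati.qsrank F = rf)
    (hrq : QSRiccati.qsrank Q = rq)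
    (hA : QSRiccati.realNumericalRange A ⊆ {z : ℂ | z.re < 0})
    (hF : F.PosDef) (hQ : Q.PosSemidef)
    (hX : X.PosSemidef) (hCARE : Aᵀ * X + X * A - X * F * X + Q = 0)
    (hL : QSRiccati.IsCholeskyFactor L F)
    (hW : QSRiccati.realNumericalRange (L⁻¹ * A * L) ⊆ {z : ℂ | z.re < 0}) :
    ∀ h : ℕ, 1 ≤ h → ∀ s : ℕ, 1 ≤ s → s < n →
      QSRiccati.sigma (h * (4 * ra + 6 * rf + 2 * rq) + rf + 1) (QSRiccati.lowerBlock X s) / ‖X‖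
          ≤ QSRiccati.cond F * (1 + Real.sqrt 2) ^ 2 *
            QSRiccati.zolotarev h (QSRiccati.setE A F Q L) (-QSRiccati.setE A F Q L) ∧
      QSRiccati.sigma (h * (4 * ra + 6 * rf + 2 * rq) + rf + 1) (QSRiccati.upperBlock X s) / ‖X‖
          ≤ QSRiccati.cond F * (1 + Real.sqrt 2) ^ 2 *
            QSRiccati.zolotarev h (QSRiccati.setE A F Q L) (-QSRiccati.setE A F Q L) := by
  intro h _ s hs hsn
  subst hra hrf hrq
  have hE := QSRiccati.isCompact_setE A F Q L
  have hc : 0 ≤ QSRiccati.cond F * (1 + Real.sqrt 2) ^ 2 :=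
    mul_nonneg (mul_nonneg (norm_nonneg _) (norm_nonneg _)) (sq_nonneg _)
  have key := fun (p q : Polynomial ℂ) (hp : p.natDegree ≤ h) (hq : q.natDegree ≤ h)
      (hqE : ∀ z ∈ QSRiccati.setE A F Q L, q.eval z ≠ 0)
      (hpE : ∀ z ∈ -QSRiccati.setE A F Q L, p.eval z ≠ 0) =>
    QSRiccati.sigma_block_le_mul_mul hX hCARE hL hW hs hsn hp hq hqE hpE
      ENNReal.toReal_nonneg ENNReal.toReal_nonneg
      (fun z hz => QSRiccati.norm_eval_le_iSup_ratModulus_mul hE p hqE hz)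
      (fun z hz => QSRiccati.norm_eval_le_iSup_ratModulus_mul hE.neg q hpE hz)
  constructor
  · refine QSRiccati.le_mul_zolotarev hE hE.neg hc fun p q hp hq hqE hpE => ?_
    -- A bound by a multiple of ‖X‖ suffices even for X = 0, where the quotient is 0.
    refine div_le_of_le_mul₀ (norm_nonneg _) (by positivity) ?_
    rw [mul_assoc (QSRiccati.cond F)]
    exact (key p q hp hq hqE hpE).1
  · refine QSRiccati.le_mul_zolotarev hE hE.neg hc fun p q hp hq hqE hpE => ?_
    refine div_le_of_le_mul₀ (norm_nonneg _) (by positivity) ?_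
    rw [mul_assoc (QSRiccati.cond F)]
    exact (key p q hp hq hqE hpE).2
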